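/- Let $\mathbb F_q$ be a finite field with $q$ elements, $n\ge1$, and let $G_n$ be the group of elements $g(\alpha;\beta)$, $\alpha\in\mathbb F_q^{n}$, $\beta\in\mathbb F_q^{n-1}$, with product $g(\alpha;\beta)g(\alpha';\beta')=g(\alpha+\alpha';\gamma)$, $\gamma_j=\beta_j+\beta'_j+\alpha_j\alpha'_{j+1}$ (unitriangular $(n+1)\times(n+1)$ matrices, truncated above the second superdiagonal). It acts on the dual $\mathfrak g_n^*=\{F=(x,y):x\in\mathbb F_q^{n},\,y\in\mathbb F_q^{n-1}\}$ of its Lie algebra by the coadjoint action $y'=y$, $x'_i=x_i+\alpha_{i-1}y_{i-1}-\alpha_{i+1}y_i$ (terms with indices out of range are $0$). Write $\operatorname{tr}(Fg)=\sum_i x_i\alpha_i+\sum_j y_j\beta_j$, and fix a non-trivial additive character $\mathbf e:\mathbb F_q\to\mathbb C^\times$. Construction. For $F\in\mathfrak g_m^*$ let $B_F$ be the representation of $G_m$ on the complex functions $f(t_2,t_4,\dots)$ of $\lfloor m/2\rfloor$ variables in $\mathbb F_q$ given by $(B_F(g)f)(t)=\mathbf e(\operatorname{tr}(Fh'))f(t')$,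 where $s(t)=g(\alpha;0)$ with $\alpha_i=t_i$ for even $i$ and $\alpha_i=0$ for odd $i$, and $t'$, $h'$ are determined by $s(t)g=h's(t')$ with $h'$ in the subgroup $\{\alpha_2=\alpha_4=\dots=0\}$ (so $t'_i=t_i+\alpha_i$). If all $y_j\neq0$, this is called a basic representation. For general $F=(x,y)\in\mathfrak g_n^*$, the zeros $i_1<\dots<i_m$ of $y$ determine the ordered partition $n=j_0+\dots+j_m$, $j_r=i_{r+1}-i_r$ ($i_0=0$, $i_{m+1}=n$). There is a projection $G_n\to G_{j_0}\times\dots\times G_{j_m}$ which forgets $\beta_{i_1},\dots,\beta_{i_m}$, and $F$ has components $F_r\in\mathfrak g_{j_r}^*$ with entries $x_{i_r+1},\dots,x_{i_{r+1}}$ and $y_{i_r+1},\dots,y_{i_{r+1}-1}$. Let $\pi_F$ be the pull-back to $G_n$ of the representation $B_{F_0}\otimes\dots\otimes B_{F_m}$ of this product. Every coadjoint orbit $\Omega$ contains exactly one standard representative, that is, one $F$ such that $x_i=0$ unless $i=i_r+1$ for some $r$ with $j_r$ odd. Choose any representative $F_\Omega\in\Omega$ of every coadjoint orbit $\Omega$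 (for instance, the standard one) and put $\pi_\Omega=\pi_{F_\Omega}$. Then: 1. every coadjoint orbit $\Omega$ has even dimension $2k$ over $\mathbb F_q$ (the dimension of its affine span), has $q^{2k}$ elements, and $\dim_{\mathbb C}\pi_\Omega=q^k$; 2. every $\pi_\Omega$ is irreducible; 3. $\pi_\Omega$ and $\pi_{\Omega'}$ are inequivalent if $\Omega\ne\Omega'$; 4. $\sum_\Omega(\dim\pi_\Omega)^2=|G_n|=q^{2n-1}$, and every irreducible complex representation of $G_n$ is equivalent to $\pi_\Omega$ for precisely one coadjoint orbit $\Omega$. -/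

import Mathlib

/-! Matrix entries are indexed from `0`: the entry `α i` below is the one usually written
`α_{i+1}`, and similarly for `β`, `a`, `b`, `x`, `y`. -/

/-- The two-diagonal group `G_n` over `K`: `(n+1) × (n+1)` upper unitriangular matrices modulo
everything above the second superdiagonal. The element with first superdiagonal `α` and second
superdiagonal `β` is `g(α; β)`. -/
@[ext]
structure TDGroup (n : ℕ) (K : Type*) where
  α : Fin n → K
  β : Fin (n - 1) → K

/-- For `j < n - 1`, the index `j` viewed in `Fin n`. -/
def TDGroup.lo {n : ℕ} (j : Fin (n - 1)) : Fin n := ⟨j.val, by have := j.isLt; omega⟩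

/-- For `j < n - 1`, the index `j + 1` viewed in `Fin n`. -/
def TDGroup.hi {n : ℕ} (j : Fin (n - 1)) : Fin n := ⟨j.val + 1, by have := j.isLt; omega⟩

namespace TDGroup

variable {n : ℕ} {K : Type*} [Field K]

instance : Mul (TDGroup n K) :=
  ⟨fun g h => ⟨fun i => g.α i + h.α i, fun j => g.β j + h.β j + g.α (lo j) * h.α (hi j)⟩⟩

instance : One (TDGroup n K) := ⟨⟨fun _ => 0, fun _ => 0⟩⟩

instance : Inv (TDGroup n K) :=
  ⟨fun g => ⟨fun i => -g.α i, fun j => -g.β j + g.α (lo j) * g.α (hi j)⟩⟩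

@[simp] lemma mul_α (g h : TDGroup n K) (i : Fin n) : (g * h).α i = g.α i + h.α i := rfl

@[simp] lemma mul_β (g h : TDGroup n K) (j : Fin (n - 1)) :
    (g * h).β j = g.β j + h.β j + g.α (lo j) * h.α (hi j) := rfl

@[simp] lemma one_α (i : Fin n) : (1 : TDGroup n K).α i = 0 := rfl

@[simp] lemma one_β (j : Fin (n - 1)) : (1 : TDGroup n K).β j = 0 := rfl

@[simp] lemma inv_α (g : TDGroup n K) (i : Fin n) : (g⁻¹).α i = -g.α i := rfl

@[simp] lemma inv_β (g : TDGroup n K) (j : Fin (n - 1)) :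
    (g⁻¹).β j = -g.β j + g.α (lo j) * g.α (hi j) := rfl

instance : Group (TDGroup n K) :=
  Group.ofLeftAxioms
    (fun a b c => by ext <;> simp <;> ring)
    (fun a => by ext <;> simp)
    (fun a => by ext <;> simp)

end TDGroup

/-- The Lie algebra `g_n`: pairs `(a, b)`, the first and second superdiagonals. -/
abbrev TDAlgebra (n : ℕ) (K : Type*) := (Fin n → K) × (Fin (n - 1) → K)

/-- The dual space `g_n^*`: pairs `F = (x, y)`, the first and second subdiagonals. -/
def TDDual (n : ℕ) (K : Type*) := (Fin n → K) × (Fin (n - 1) → K)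

namespace TDDual

variable {n : ℕ} {K : Type*}

/-- The first subdiagonal. -/
def x (F : TDDual n K) : Fin n → K := F.1

/-- The second subdiagonal. -/
def y (F : TDDual n K) : Fin (n - 1) → K := F.2

@[ext] lemma ext {F F' : TDDual n K} (hx : ∀ i, F.x i = F'.x i) (hy : ∀ j, F.y j = F'.y j) :
    F = F' := Prod.ext (funext hx) (funext hy)

instance [Finite K] : Finite (TDDual n K) :=
  inferInstanceAs (Finite ((Fin n → K) × (Fin (n - 1) → K)))

variable [Field K]

instance : AddCommGroup (TDDual n K) :=
  inferInstanceAs (AddCommGroup ((Fin n → K) × (Fin (n - 1) → K)))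

instance : Module K (TDDual n K) :=
  inferInstanceAs (Module K ((Fin n → K) × (Fin (n - 1) → K)))

/-- The duality `⟨F, A⟩ = tr (F A)` between `g_n^*` and `g_n`. -/
def pairing (F : TDDual n K) (A : TDAlgebra n K) : K :=
  ∑ i, F.x i * A.1 i + ∑ j, F.y j * A.2 j

/-- `tr (F g)` for a group element `g`. -/
def traceForm (F : TDDual n K) (g : TDGroup n K) : K :=
  ∑ i, F.x i * g.α i + ∑ j, F.y j * g.β j

/-- The coadjoint action in coordinates:
`x'_i = x_i + α_{i-1} y_{i-1} - α_{i+1} y_i` and `y' = y`, where terms whose indices are out of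
range are zero. -/
instance : SMul (TDGroup n K) (TDDual n K) :=
  ⟨fun g F =>
    (fun i => F.x i
        + (if h : 0 < i.val then
            g.α ⟨i.val - 1, by omega⟩ * F.y ⟨i.val - 1, by omega⟩ else 0)
        - (if h : i.val + 1 < n then g.α ⟨i.val + 1, h⟩ * F.y ⟨i.val, by omega⟩ else 0),
      F.y)⟩

lemma smul_x (g : TDGroup n K) (F : TDDual n K) (i : Fin n) :
    (g • F).x i = F.x i
        + (if h : 0 < i.val then
            g.α ⟨i.val - 1, by omega⟩ * F.y ⟨i.val - 1, by omega⟩ else 0)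
        - (if h : i.val + 1 < n then g.α ⟨i.val + 1, h⟩ * F.y ⟨i.val, by omega⟩ else 0) := rfl

@[simp] lemma smul_y (g : TDGroup n K) (F : TDDual n K) : (g • F).y = F.y := rfl

instance : MulAction (TDGroup n K) (TDDual n K) where
  one_smul F := by
    ext i
    · simp [smul_x]
    · simp
  mul_smul g h F := by
    ext i
    · simp only [smul_x, smul_y, TDGroup.mul_α]
      split_ifs <;> ring
    · simp

end TDDual

/-- The adjoint action `A ↦ g A g⁻¹` (truncated above the second superdiagonal) in coordinates:
`a' = a` and `b'_j = b_j + α_j a_{j+1} - α_{j+1} a_j`. -/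
def TDGroup.adjoint {n : ℕ} {K : Type*} [Field K] (g : TDGroup n K) (A : TDAlgebra n K) :
    TDAlgebra n K :=
  (A.1, fun j => A.2 j + g.α (TDGroup.lo j) * A.1 (TDGroup.hi j)
    - g.α (TDGroup.hi j) * A.1 (TDGroup.lo j))

/-- The coadjoint action is dual to the adjoint one. (The formula `⟨g F, A⟩ = ⟨F, Ad(g⁻¹) A⟩`
differs from this one by replacing `g` with `g⁻¹`; as only `α` acts, and additively, both are left
actions, with the same orbits.) -/
lemma TDDual.pairing_smul {n : ℕ} {K : Type*} [Field K] (g : TDGroup n K) (F : TDDual n K)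
    (A : TDAlgebra n K) : (g • F).pairing A = F.pairing (g.adjoint A) := by
  rcases n with _ | m
  · simp [TDDual.pairing, TDGroup.adjoint]
  · have h1 : ∑ i : Fin (m + 1), (if h : 0 < i.val then
        g.α ⟨i.val - 1, by omega⟩ * F.y ⟨i.val - 1, by omega⟩ else 0) * A.1 i
        = ∑ j : Fin (m + 1 - 1), F.y j * (g.α (TDGroup.lo j) * A.1 (TDGroup.hi j)) := by
      show _ = ∑ j : Fin m, F.y j *
        (g.α (TDGroup.lo (n := m + 1) j) * A.1 (TDGroup.hi (n := m + 1) j))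
      rw [Fin.sum_univ_succ, dif_neg (by simp), zero_mul, zero_add]
      refine Finset.sum_congr rfl fun j _ => ?_
      rw [dif_pos (by simp)]
      show g.α (TDGroup.lo (n := m + 1) j) * F.y j * A.1 (TDGroup.hi (n := m + 1) j) = _
      ring
    have h2 : ∑ i : Fin (m + 1), (if h : i.val + 1 < m + 1 then
        g.α ⟨i.val + 1, h⟩ * F.y ⟨i.val, by omega⟩ else 0) * A.1 i
        = ∑ j : Fin (m + 1 - 1), F.y j * (g.α (TDGroup.hi j) * A.1 (TDGroup.lo j)) := by
      show _ = ∑ j : Fin m, F.y j *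
        (g.α (TDGroup.hi (n := m + 1) j) * A.1 (TDGroup.lo (n := m + 1) j))
      rw [Fin.sum_univ_castSucc, dif_neg (by simp), zero_mul, add_zero]
      refine Finset.sum_congr rfl fun j _ => ?_
      rw [dif_pos (by simp)]
      show g.α (TDGroup.hi (n := m + 1) j) * F.y j * A.1 (TDGroup.lo (n := m + 1) j) = _
      ring
    simp only [TDDual.pairing, TDDual.smul_x, TDDual.smul_y, TDGroup.adjoint, add_mul, sub_mul,
      mul_add, mul_sub, Finset.sum_add_distrib, Finset.sum_sub_distrib]
    rw [h1, h2]
    abel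

/-- The set of coadjoint orbits of `G_n`. -/
abbrev CoadjointOrbit (n : ℕ) (K : Type*) [Field K] :=
  MulAction.orbitRel.Quotient (TDGroup n K) (TDDual n K)

noncomputable instance (n : ℕ) (K : Type*) [Field K] [Finite K] : Fintype (CoadjointOrbit n K) :=
  Fintype.ofFinite _

/-- The dimension over `K` of a coadjoint orbit, which is an affine subspace of `g_n^*`. -/
noncomputable def CoadjointOrbit.dim {n : ℕ} {K : Type*} [Field K] (Ω : CoadjointOrbit n K) : ℕ :=
  Module.finrank K (vectorSpan K Ω.orbit)

/-! ### Basic representations -/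

/-- The indices of the coordinates `t_2, t_4, t_6, …` (index `i` carries `t_{i+1}`). -/
abbrev EvenIndex (n : ℕ) := {i : Fin n // Even (i.val + 1)}

namespace TDGroup

variable {n : ℕ} {K : Type*} [Field K]

/-- The polarization subgroup `H ⊆ G_n`: `α_2 = α_4 = ⋯ = 0`. -/
def polarization (n : ℕ) (K : Type*) [Field K] : Subgroup (TDGroup n K) where
  carrier := {h | ∀ i : EvenIndex n, h.α i = 0}
  mul_mem' ha hb i := by simp [ha i, hb i]
  one_mem' i := by simp
  inv_mem' ha i := by simp [ha i]

/-- The representative `s(t)` of the point `t` of `T = H \ G_n`: the matrix with `α_i = t_i` for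
even (1-based) `i` and all other entries zero. -/
def sec (t : EvenIndex n → K) : TDGroup n K where
  α i := if h : Even (i.val + 1) then t ⟨i, h⟩ else 0
  β _ := 0

/-- The right action of `g` on `T = H \ G_n`, in the coordinates `t`: `t'_i = t_i + α_i`. -/
def shift (t : EvenIndex n → K) (g : TDGroup n K) : EvenIndex n → K := fun i => t i + g.α i

/-- The element `h' = s(t) g s(t')⁻¹`, which solves the master equation `s(t) g = h' s(t')`. -/
def master (t : EvenIndex n → K) (g : TDGroup n K) : TDGroup n K :=
  sec t * g * (sec (shift t g))⁻¹

lemma master_mem (t : EvenIndex n → K) (g : TDGroup n K) : master t g ∈ polarization n K := by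
  intro i
  have h := i.2
  simp [master, sec, shift, h]

lemma shift_one (t : EvenIndex n → K) : shift t (1 : TDGroup n K) = t := by
  funext i; simp [shift]

lemma shift_mul (t : EvenIndex n → K) (g g' : TDGroup n K) :
    shift t (g * g') = shift (shift t g) g' := by
  funext i; simp [shift, add_assoc]

lemma master_one (t : EvenIndex n → K) : master t (1 : TDGroup n K) = 1 := by
  simp [master, shift_one]

lemma master_mul (t : EvenIndex n → K) (g g' : TDGroup n K) :
    master t (g * g') = master t g * master (shift t g) g' := by
  simp only [master, shift_mul]; group

end TDGroup

namespace TDDual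

variable {n : ℕ} {K : Type*} [Field K]

lemma traceForm_one (F : TDDual n K) : F.traceForm 1 = 0 := by simp [traceForm]

lemma traceForm_mul (F : TDDual n K) {h h' : TDGroup n K} (hh : h ∈ TDGroup.polarization n K)
    (hh' : h' ∈ TDGroup.polarization n K) :
    F.traceForm (h * h') = F.traceForm h + F.traceForm h' := by
  have key : ∀ j : Fin (n - 1), h.α (TDGroup.lo j) * h'.α (TDGroup.hi j) = 0 := by
    intro j
    rcases Nat.even_or_odd (j.val + 1) with hj | hj
    · have := hh ⟨TDGroup.lo j, hj⟩
      simp only at this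
      rw [this, zero_mul]
    · have := hh' ⟨TDGroup.hi j, hj.add_one⟩
      simp only at this
      rw [this, mul_zero]
  simp only [traceForm, TDGroup.mul_α, TDGroup.mul_β, key, add_zero, mul_add,
    Finset.sum_add_distrib]
  ring

/-- The representation of `G_n` on the space of functions `f(t_2, t_4, …)` attached to `F` and to
the polarization `α_2 = α_4 = ⋯ = 0`: `(π(g) f)(t) = e(tr(F h')) f(t')`, where `s(t) g = h' s(t')`.
If all entries of `y` are non-zero, this is the basic representation attached to the (basic) orbit
of `F`. -/
def basicRep (e : AddChar K ℂ) (F : TDDual n K) :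
    Representation ℂ (TDGroup n K) ((EvenIndex n → K) → ℂ) where
  toFun g :=
    { toFun := fun f t => e (F.traceForm (TDGroup.master t g)) * f (TDGroup.shift t g)
      map_add' := fun f f' => by funext t; simp [mul_add]
      map_smul' := fun c f => by funext t; simp; ring }
  map_one' := by
    ext f t
    simp [TDGroup.master_one, TDGroup.shift_one, traceForm_one]
  map_mul' g g' := by
    refine LinearMap.ext fun f => funext fun t => ?_
    show e _ * f _ = e _ * (e _ * f _)
    rw [TDGroup.master_mul, traceForm_mul F (TDGroup.master_mem _ _) (TDGroup.master_mem _ _),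
      AddChar.map_add_eq_mul, TDGroup.shift_mul, mul_assoc]

end TDDual

/-! ### The projection to a product of smaller groups, and the general representations -/

/-- For the ordered partition `c` of `n` with parts `j_0, j_1, …`, the position in the `β` (or `y`)
diagonal of the `j`-th entry of block `r`. -/
def Composition.blockPos {n : ℕ} (c : Composition n) (r : Fin c.length)
    (j : Fin (c.blocksFun r - 1)) : Fin (n - 1) :=
  ⟨c.sizeUpTo r + j.val, by
    have h := (c.embedding r (TDGroup.hi j)).isLt
    have h' : (c.embedding r (TDGroup.hi j)).val = c.sizeUpTo r + (j.val + 1) := rfl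
    omega⟩

/-- The projection `G_n → G_{j_0} × G_{j_1} × ⋯` attached to an ordered partition of `n`. -/
def TDGroup.proj {n : ℕ} {K : Type*} [Field K] (c : Composition n) :
    TDGroup n K →* ((r : Fin c.length) → TDGroup (c.blocksFun r) K) where
  toFun g r := ⟨fun i => g.α (c.embedding r i), fun j => g.β (c.blockPos r j)⟩
  map_one' := rfl
  map_mul' _ _ := rfl

namespace TDDual

variable {n : ℕ} {K : Type*} [Field K]

open Classical in
/-- The ordered partition `n = j_0 + ⋯ + j_m` attached to `F`: the partial sums
`j_0 + ⋯ + j_{r-1}` with `1 ≤ r ≤ m` are the (1-based) positions `i` with `y_i = 0`. -/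
noncomputable def partition (F : TDDual n K) : Composition n :=
  ((compositionAsSetEquiv n).symm (Finset.univ.filter fun j => F.y j = 0)).toComposition

/-- The component in `g_{j_r}^*` of `F`. -/
def block (F : TDDual n K) (c : Composition n) (r : Fin c.length) : TDDual (c.blocksFun r) K :=
  (fun i => F.x (c.embedding r i), fun j => F.y (c.blockPos r j))

/-- `F` is a standard representative of its orbit: all its `x`-entries vanish, except possibly the
first one in each block of odd size. -/
def IsStandard (F : TDDual n K) : Prop :=
  ∀ r : Fin F.partition.length, ∀ i : Fin (F.partition.blocksFun r),
    (F.block F.partition r).x i ≠ 0 → i.val = 0 ∧ Odd (F.partition.blocksFun r)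

/-- The space of the representation attached to `F`: the tensor product of the spaces of the basic
representations of `G_{j_0}, G_{j_1}, …`. -/
abbrev RepSpace (F : TDDual n K) :=
  PiTensorProduct ℂ fun r : Fin F.partition.length =>
    (EvenIndex (F.partition.blocksFun r) → K) → ℂ

/-- The representation of `G_n` given by the orbit method for the representative `F` of an orbit:
the tensor product of the basic representations of `G_{j_0}, G_{j_1}, …` attached to the
components of `F`, pulled back along the projection `G_n → G_{j_0} × G_{j_1} × ⋯`. -/
noncomputable def orbitRep (e : AddChar K ℂ) (F : TDDual n K) :
    Representation ℂ (TDGroup n K) F.RepSpace :=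
  (PiTensorProduct.mapMonoidHom.comp
    (MonoidHom.pi fun r =>
      ((F.block F.partition r).basicRep e).comp (Pi.evalMonoidHom _ r))).comp
    (TDGroup.proj F.partition)

end TDDual

/-! ### Blocks cut out by the zeros of `y`, and parity of positions in them -/

namespace TDDual

variable {n : ℕ} {K : Type*} [Field K]

/-! Call an index even if its 1-based position in its block is even. The displacement `coad` joins
neighbours only across a non-zero `y j`, hence only inside a block, so it interchanges even and odd
positions. Two elimination arguments control it: odd-supported vectors reach every value on even
positions (`exists_coad_eq_on_even`), and an even-supported vector is determined by its image on the
odd positions, even when the first position of each odd block is ignored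
(`eq_zero_of_coad_eq_zero`). A count turns this injectivity into bijectivity. Hence an orbit is an
affine space of dimension twice the number of even positions, the ignored positions parametrize its
standard representative, and it contains every `F'` with the same `y` and the same odd `x`-entries.

On the normal subgroup `polar`, `e (tr (F h))` is a character, and `orbitRep` is the representation
induced from it, realized on functions of the even coordinates (`model_orbitRep`). Delta functions
are eigenvectors of `polar` with pairwise distinct characters, permuted transitively up to scalars
by `G_n`: this gives irreducibility.

Everything else is Frobenius reciprocity, phrased with eigenfunctionals, that is,
`polar`-equivariant maps to a character. One for `F'` on the representation of `F` forces `F'` into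
the orbit of `F` (`IsEigenfunctional.mem_orbit`), so different orbits are inequivalent. Fourier
inversion produces one on any non-zero representation (`exists_isEigenfunctional`), and on an
irreducible one it yields an isomorphism with some `orbitRep` (`IsEigenfunctional.nonempty_equiv`).
Completeness thus does not rest on the sum of squares, which is just the count of `g_n^*` by orbits.
-/

lemma y_eq_zero_iff (F : TDDual n K) (j : Fin (n - 1)) :
    F.y j = 0 ↔ ∃ k, F.partition.sizeUpTo k = j.val + 1 := by
  classical
  have hj := j.isLt
  let s : Finset (Fin (n - 1)) := Finset.univ.filter fun j => F.y j = 0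
  have h1 : F.y j = 0 ↔ j ∈ (compositionAsSetEquiv n) ((compositionAsSetEquiv n).symm s) := by
    simp [s]
  have h2 : j ∈ (compositionAsSetEquiv n) ((compositionAsSetEquiv n).symm s) ↔
      (⟨j.val + 1, by omega⟩ : Fin (n + 1)) ∈ ((compositionAsSetEquiv n).symm s).boundaries := by
    generalize (compositionAsSetEquiv n).symm s = c
    simp only [compositionAsSetEquiv, Equiv.coe_fn_mk, Set.mem_toFinset, Set.mem_ofPred_eq, add_comm 1]
  have h3 : F.partition.boundaries = ((compositionAsSetEquiv n).symm s).boundaries := by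
    rw [← CompositionAsSet.toComposition_boundaries]
    simp only [partition, s]
  rw [h1, h2, ← h3]
  simp only [Composition.boundaries, Finset.mem_map, Finset.mem_univ, true_and]
  constructor
  · rintro ⟨k, hk⟩
    exact ⟨k, congrArg Fin.val hk⟩
  · rintro ⟨k, hk⟩
    have hkl : k ≤ F.partition.length := by
      by_contra hkl
      rw [Composition.sizeUpTo_ofLength_le _ _ (by omega)] at hk
      omega
    exact ⟨⟨k, by omega⟩, Fin.ext hk⟩

lemma partition_step (F : TDDual n K) {j : Fin (n - 1)} (hy : F.y j ≠ 0) :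
    F.partition.index (TDGroup.hi j) = F.partition.index (TDGroup.lo j) ∧
      (F.partition.invEmbedding (TDGroup.hi j)).val =
        (F.partition.invEmbedding (TDGroup.lo j)).val + 1 := by
  set c := F.partition with hc
  obtain ⟨r, p, hp⟩ : ∃ r p, c.embedding r p = TDGroup.lo j := ⟨_, _, c.embedding_comp_inv _⟩
  have hv : c.sizeUpTo r + p.val = j.val := congrArg Fin.val hp
  -- Otherwise `j` is the last index of block `r`, so the block ends at `j + 1` and `y j` would
  -- vanish.
  have hlt : p.val + 1 < c.blocksFun r := by
    by_contra hlt
    refine hy ((y_eq_zero_iff F j).2 ⟨r + 1, ?_⟩)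
    have := p.isLt
    rw [← hc, c.sizeUpTo_succ' r]
    omega
  have hhi : TDGroup.hi j = c.embedding r ⟨p.val + 1, hlt⟩ := Fin.ext (by
    show j.val + 1 = c.sizeUpTo r + (p.val + 1)
    omega)
  refine ⟨by rw [hhi, c.index_embedding, ← hp, c.index_embedding], ?_⟩
  rw [hhi, c.invEmbedding_comp, ← hp, c.invEmbedding_comp]

lemma partition_cut (F : TDDual n K) {j : Fin (n - 1)} (hy : F.y j = 0) :
    (F.partition.invEmbedding (TDGroup.hi j)).val = 0 ∧
      (F.partition.invEmbedding (TDGroup.lo j)).val + 1 =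
        F.partition.blocksFun (F.partition.index (TDGroup.lo j)) := by
  obtain ⟨k, hk⟩ := (y_eq_zero_iff F j).1 hy
  set c := F.partition with hc
  rw [c.coe_invEmbedding, c.coe_invEmbedding]
  have h1 := c.sizeUpTo_index_le (TDGroup.hi j)
  have h2 := c.lt_sizeUpTo_index_succ (TDGroup.hi j)
  have h3 := c.sizeUpTo_index_le (TDGroup.lo j)
  have h4 := c.lt_sizeUpTo_index_succ (TDGroup.lo j)
  have h5 := c.sizeUpTo_succ' (c.index (TDGroup.lo j))
  have e1 : (TDGroup.hi j).val = j.val + 1 := rfl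
  have e2 : (TDGroup.lo j).val = j.val := rfl
  have key : ∀ a b : ℕ, c.sizeUpTo a < c.sizeUpTo b → a < b := fun a b h => by
    by_contra h'
    exact absurd (c.monotone_sizeUpTo (not_lt.1 h')) (by omega)
  simp only [Fin.val_succ] at h2 h4
  have k1 := key k _ (by omega : c.sizeUpTo k < c.sizeUpTo ((c.index (TDGroup.hi j)).val + 1))
  have k2 := c.monotone_sizeUpTo (by omega : k ≤ (c.index (TDGroup.hi j)).val)
  have k3 := key _ k (by omega : c.sizeUpTo (c.index (TDGroup.lo j)).val < c.sizeUpTo k)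
  have k4 := c.monotone_sizeUpTo (by omega : (c.index (TDGroup.lo j)).val + 1 ≤ k)
  constructor <;> omega

lemma invEmbedding_of_val_eq_zero (c : Composition n) {i : Fin n} (hi : i.val = 0) :
    (c.invEmbedding i).val = 0 := by
  rw [c.coe_invEmbedding]; omega

lemma invEmbedding_of_val_add_one_eq (c : Composition n) {i : Fin n} (hi : i.val + 1 = n) :
    (c.invEmbedding i).val + 1 = c.blocksFun (c.index i) := by
  rw [c.coe_invEmbedding]
  have h1 := c.sizeUpTo_index_le i
  have h2 := c.lt_sizeUpTo_index_succ i
  have h3 := c.sizeUpTo_succ' (c.index i)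
  have h4 := c.sizeUpTo_le ((c.index i).val + 1)
  simp only [Fin.val_succ] at h2
  omega

/-- The index `i` has an even (1-based) position in its block. -/
def IsEvenIndex (F : TDDual n K) (i : Fin n) : Prop :=
  Even ((F.partition.invEmbedding i).val + 1)

/-- The index `i` lies in a block of odd size. -/
def InOddBlock (F : TDDual n K) (i : Fin n) : Prop :=
  Odd (F.partition.blocksFun (F.partition.index i))

lemma isEvenIndex_hi (F : TDDual n K) {j : Fin (n - 1)} (hy : F.y j ≠ 0) :
    F.IsEvenIndex (TDGroup.hi j) ↔ ¬ F.IsEvenIndex (TDGroup.lo j) := by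
  rw [IsEvenIndex, IsEvenIndex, (partition_step F hy).2]
  simp only [Nat.even_add_one]

lemma not_isEvenIndex_hi (F : TDDual n K) {j : Fin (n - 1)} (hy : F.y j = 0) :
    ¬ F.IsEvenIndex (TDGroup.hi j) := by
  rw [IsEvenIndex, (partition_cut F hy).1]
  simp

lemma not_isEvenIndex_of_val_eq_zero (F : TDDual n K) {i : Fin n} (hi : i.val = 0) :
    ¬ F.IsEvenIndex i := by
  rw [IsEvenIndex, invEmbedding_of_val_eq_zero _ hi]
  simp

lemma inOddBlock_hi (F : TDDual n K) {j : Fin (n - 1)} (hy : F.y j ≠ 0) :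
    F.InOddBlock (TDGroup.hi j) ↔ F.InOddBlock (TDGroup.lo j) := by
  rw [InOddBlock, InOddBlock, (partition_step F hy).1]

/-- Just before a cut, the position in the block equals the block size, so the two parities agree.
-/
lemma inOddBlock_lo_iff (F : TDDual n K) {j : Fin (n - 1)} (hy : F.y j = 0) :
    F.InOddBlock (TDGroup.lo j) ↔ ¬ F.IsEvenIndex (TDGroup.lo j) := by
  rw [InOddBlock, IsEvenIndex, ← Nat.not_even_iff_odd, (partition_cut F hy).2]

lemma inOddBlock_of_val_add_one_eq (F : TDDual n K) {i : Fin n} (hi : i.val + 1 = n) :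
    F.InOddBlock i ↔ ¬ F.IsEvenIndex i := by
  rw [InOddBlock, IsEvenIndex, ← Nat.not_even_iff_odd, invEmbedding_of_val_add_one_eq _ hi]

lemma isStandard_iff (F : TDDual n K) :
    F.IsStandard ↔ ∀ i, F.x i ≠ 0 → (F.partition.invEmbedding i).val = 0 ∧ F.InOddBlock i := by
  constructor
  · intro h i hi
    refine h (F.partition.index i) (F.partition.invEmbedding i) ?_
    rw [block]
    show F.x _ ≠ 0
    rwa [F.partition.embedding_comp_inv]
  · intro h r i hi
    have := h _ hi
    rwa [InOddBlock, F.partition.invEmbedding_comp, F.partition.index_embedding] at this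

end TDDual

/-! ### Linear algebra of the coadjoint displacement -/

namespace TDDual

variable {n : ℕ} {K : Type*} [Field K]

/-- The displacement `x' - x` produced by the coadjoint action, as a linear function of `α`. -/
def coad (F : TDDual n K) : (Fin n → K) →ₗ[K] (Fin n → K) where
  toFun α i := (if h : 0 < i.val then α ⟨i.val - 1, by omega⟩ * F.y ⟨i.val - 1, by omega⟩ else 0)
    - (if h : i.val + 1 < n then α ⟨i.val + 1, h⟩ * F.y ⟨i.val, by omega⟩ else 0)
  map_add' α β := by
    funext i
    simp only [Pi.add_apply]
    split_ifs <;> ring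
  map_smul' c α := by
    funext i
    simp only [Pi.smul_apply, smul_eq_mul, RingHom.id_apply]
    split_ifs <;> ring

lemma coad_apply (F : TDDual n K) (α : Fin n → K) (i : Fin n) :
    F.coad α i = (if h : 0 < i.val then
        α ⟨i.val - 1, by omega⟩ * F.y ⟨i.val - 1, by omega⟩ else 0)
      - (if h : i.val + 1 < n then α ⟨i.val + 1, h⟩ * F.y ⟨i.val, by omega⟩ else 0) := rfl

lemma smul_x_eq (g : TDGroup n K) (F : TDDual n K) (i : Fin n) :
    (g • F).x i = F.x i + F.coad g.α i := by
  rw [smul_x, coad_apply, add_sub_assoc]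

lemma coad_congr (F : TDDual n K) {α β : Fin n → K} {i : Fin n}
    (h1 : ∀ j, TDGroup.hi j = i → F.y j ≠ 0 → α (TDGroup.lo j) = β (TDGroup.lo j))
    (h2 : ∀ j, TDGroup.lo j = i → F.y j ≠ 0 → α (TDGroup.hi j) = β (TDGroup.hi j)) :
    F.coad α i = F.coad β i := by
  rw [coad_apply, coad_apply]
  congr 1
  · split_ifs with h
    · by_cases hy : F.y ⟨i.val - 1, by omega⟩ = 0
      · rw [hy, mul_zero, mul_zero]
      · congr 1
        refine h1 ⟨i.val - 1, by omega⟩ (Fin.ext ?_) hy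
        show i.val - 1 + 1 = i.val
        omega
    · rfl
  · split_ifs with h
    · by_cases hy : F.y ⟨i.val, by omega⟩ = 0
      · rw [hy, mul_zero, mul_zero]
      · congr 1
        exact h2 ⟨i.val, by omega⟩ rfl hy
    · rfl

/-- Elimination step: once the left neighbour contributes nothing, a single unknown remains, with
coefficient `-y j`. `coad_hi` is the mirror image. -/
lemma coad_lo (F : TDDual n K) {α : Fin n → K} (j : Fin (n - 1))
    (h : ∀ k, TDGroup.hi k = TDGroup.lo j → F.y k ≠ 0 → α (TDGroup.lo k) = 0) :
    F.coad α (TDGroup.lo j) = - (α (TDGroup.hi j) * F.y j) := by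
  have hj := j.isLt
  have : F.coad α (TDGroup.lo j) = F.coad (Pi.single (TDGroup.hi j) (α (TDGroup.hi j)))
      (TDGroup.lo j) := by
    refine F.coad_congr (fun k hk hy => ?_) (fun k hk _ => ?_)
    · rw [h k hk hy, Pi.single_eq_of_ne]
      intro h'
      have h1 : k.val + 1 = j.val := congrArg Fin.val hk
      have h2 : k.val = j.val + 1 := congrArg Fin.val h'
      omega
    · obtain rfl : k = j := Fin.ext (congrArg Fin.val hk :)
      rw [Pi.single_eq_same]
  rw [this, coad_apply, dif_pos (show (TDGroup.lo j).val + 1 < n by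
    show j.val + 1 < n
    omega)]
  have e : (⟨(TDGroup.lo j).val + 1, by show j.val + 1 < n; omega⟩ : Fin n) = TDGroup.hi j := rfl
  rw [e, Pi.single_eq_same]
  split_ifs with h0
  · rw [Pi.single_eq_of_ne, zero_mul, zero_sub]
    · rfl
    · intro h'
      have h1 : j.val - 1 = j.val + 1 := congrArg Fin.val h'
      omega
  · rw [zero_sub]
    rfl

lemma coad_hi (F : TDDual n K) {α : Fin n → K} (j : Fin (n - 1))
    (h : ∀ k, TDGroup.lo k = TDGroup.hi j → F.y k ≠ 0 → α (TDGroup.hi k) = 0) :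
    F.coad α (TDGroup.hi j) = α (TDGroup.lo j) * F.y j := by
  have : F.coad α (TDGroup.hi j) = F.coad (Pi.single (TDGroup.lo j) (α (TDGroup.lo j)))
      (TDGroup.hi j) := by
    refine F.coad_congr (fun k hk _ => ?_) (fun k hk hy => ?_)
    · obtain rfl : k = j := Fin.ext (Nat.succ_injective (congrArg Fin.val hk :))
      rw [Pi.single_eq_same]
    · rw [h k hk hy, Pi.single_eq_of_ne]
      intro h'
      have h1 : k.val = j.val + 1 := congrArg Fin.val hk
      have h2 : k.val + 1 = j.val := congrArg Fin.val h'
      omega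
  rw [this, coad_apply, dif_pos (show 0 < (TDGroup.hi j).val from Nat.succ_pos _)]
  have e : (⟨(TDGroup.hi j).val - 1, by have := (TDGroup.hi j).isLt; omega⟩ : Fin n)
      = TDGroup.lo j := rfl
  rw [e, Pi.single_eq_same]
  split_ifs with h0
  · rw [Pi.single_eq_of_ne, zero_mul, sub_zero]
    · rfl
    · intro h'
      have h1 : j.val + 1 + 1 = j.val := congrArg Fin.val h'
      omega
  · rw [sub_zero]
    rfl

lemma coad_eq_zero_of_odd (F : TDDual n K) {α : Fin n → K} (hα : ∀ i, F.IsEvenIndex i → α i = 0)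
    {i : Fin n} (hi : ¬ F.IsEvenIndex i) : F.coad α i = 0 := by
  rw [← Pi.zero_apply (M := fun _ => K) i, ← map_zero F.coad]
  refine F.coad_congr (fun j hj hy => hα _ ?_) (fun j hj hy => hα _ ?_)
  · subst hj
    by_contra h
    exact hi ((F.isEvenIndex_hi hy).2 h)
  · subst hj
    exact (F.isEvenIndex_hi hy).2 hi

lemma coad_eq_zero_of_even (F : TDDual n K) {α : Fin n → K}
    (hα : ∀ i, ¬ F.IsEvenIndex i → α i = 0) {i : Fin n} (hi : F.IsEvenIndex i) :
    F.coad α i = 0 := by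
  rw [← Pi.zero_apply (M := fun _ => K) i, ← map_zero F.coad]
  refine F.coad_congr (fun j hj hy => hα _ ?_) (fun j hj hy => hα _ ?_)
  · subst hj
    exact (F.isEvenIndex_hi hy).1 hi
  · subst hj
    exact fun h => (F.isEvenIndex_hi hy).1 h hi

lemma exists_hi_of_isEvenIndex (F : TDDual n K) {i : Fin n} (hi : F.IsEvenIndex i) :
    ∃ j, TDGroup.hi j = i ∧ F.y j ≠ 0 := by
  have h0 : i.val ≠ 0 := fun h => F.not_isEvenIndex_of_val_eq_zero h hi
  have h : TDGroup.hi (⟨i.val - 1, by omega⟩ : Fin (n - 1)) = i :=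
    Fin.ext (show i.val - 1 + 1 = i.val by omega)
  refine ⟨_, h, fun hy => F.not_isEvenIndex_hi hy ?_⟩
  rwa [h]

/-- The positions in which a standard representative may have a non-zero `x`-entry. -/
def IsFreeIndex (F : TDDual n K) (i : Fin n) : Prop :=
  (F.partition.invEmbedding i).val = 0 ∧ F.InOddBlock i

lemma not_isEvenIndex_of_isFreeIndex (F : TDDual n K) {i : Fin n} (hi : F.IsFreeIndex i) :
    ¬ F.IsEvenIndex i := by
  rw [IsEvenIndex, hi.1]
  simp

lemma not_isFreeIndex_hi (F : TDDual n K) {j : Fin (n - 1)} (hy : F.y j ≠ 0) :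
    ¬ F.IsFreeIndex (TDGroup.hi j) := by
  rintro ⟨h, -⟩
  rw [(F.partition_step hy).2] at h
  omega

/-- The hypothesis says that position and block size have opposite parities, so the index is not the
last of its block. -/
lemma exists_lo_of_inOddBlock (F : TDDual n K) {i : Fin n} (hi : F.InOddBlock i ↔ F.IsEvenIndex i) :
    ∃ j, TDGroup.lo j = i ∧ F.y j ≠ 0 := by
  have hlt : i.val + 1 ≠ n := fun h => by
    have := F.inOddBlock_of_val_add_one_eq h
    tauto
  have h : TDGroup.lo (⟨i.val, by omega⟩ : Fin (n - 1)) = i := rfl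
  refine ⟨_, h, fun hy => ?_⟩
  have := F.inOddBlock_lo_iff hy
  rw [h] at this
  tauto

/-- In a block of even size the equation at position 1 involves only `α_2`, and the entries vanish
successively from the left. In a block of odd size the equation at the last position involves only
the entry before it, and the entries vanish from the right; the equation at position 1, the free
one, is never used. -/
lemma eq_zero_of_coad_eq_zero (F : TDDual n K) {α : Fin n → K}
    (hα : ∀ i, ¬ F.IsEvenIndex i → α i = 0)
    (h : ∀ i, ¬ F.IsEvenIndex i → ¬ F.IsFreeIndex i → F.coad α i = 0) : α = 0 := by
  have up : ∀ m, ∀ i : Fin n, i.val = m → ¬ F.InOddBlock i → α i = 0 := by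
    intro m
    induction m using Nat.strong_induction_on with
    | _ m ih =>
      intro i him hO
      by_cases hi : F.IsEvenIndex i
      · obtain ⟨j, rfl, hy⟩ := F.exists_hi_of_isEvenIndex hi
        have hO' : ¬ F.InOddBlock (TDGroup.lo j) := fun h => hO ((F.inOddBlock_hi hy).2 h)
        have h0 := h (TDGroup.lo j) ((F.isEvenIndex_hi hy).1 hi) (fun h => hO' h.2)
        rw [F.coad_lo j, neg_eq_zero] at h0
        · exact (mul_eq_zero.1 h0).resolve_right hy
        · intro k hk hyk
          refine ih k.val ?_ _ rfl ?_
          · have h1 : k.val + 1 = j.val := congrArg Fin.val hk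
            have h2 : j.val + 1 = m := him
            omega
          · rwa [← F.inOddBlock_hi hyk, hk]
      · exact hα i hi
  have down : ∀ m, ∀ i : Fin n, n - i.val = m → F.InOddBlock i → α i = 0 := by
    intro m
    induction m using Nat.strong_induction_on with
    | _ m ih =>
      intro i him hO
      by_cases hi : F.IsEvenIndex i
      · obtain ⟨j, rfl, hy⟩ := F.exists_lo_of_inOddBlock (i := i) (by tauto)
        have h0 := h (TDGroup.hi j) (fun h => (F.isEvenIndex_hi hy).1 h hi)
          (F.not_isFreeIndex_hi hy)
        rw [F.coad_hi j] at h0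
        · exact (mul_eq_zero.1 h0).resolve_right hy
        · intro k hk hyk
          refine ih (n - (k.val + 1)) ?_ _ rfl ?_
          · have h1 : k.val = j.val + 1 := congrArg Fin.val hk
            have h2 : n - j.val = m := him
            have := j.isLt
            omega
          · rw [F.inOddBlock_hi hyk, hk, F.inOddBlock_hi hy]
            exact hO
      · exact hα i hi
  funext i
  by_cases hO : F.InOddBlock i
  · exact down _ i rfl hO
  · exact up _ i rfl hO

lemma exists_coad_eq_on_even (F : TDDual n K) (u : Fin n → K) :
    ∃ α : Fin n → K, (∀ i, F.IsEvenIndex i → α i = 0) ∧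
      ∀ i, F.IsEvenIndex i → F.coad α i = u i := by
  -- The equations are solved from the largest index downwards; `m` counts the top indices already
  -- treated.
  suffices H : ∀ m, ∃ α : Fin n → K, (∀ i, F.IsEvenIndex i → α i = 0) ∧
      ∀ i, F.IsEvenIndex i → n ≤ i.val + m → F.coad α i = u i by
    obtain ⟨α, h1, h2⟩ := H n
    exact ⟨α, h1, fun i hi => h2 i hi (Nat.le_add_left _ _)⟩
  intro m
  induction m with
  | zero => exact ⟨0, fun _ _ => rfl, fun i _ h => absurd i.isLt (by omega)⟩
  | succ m ih =>
    obtain ⟨α, h1, h2⟩ := ih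
    by_cases hex : ∃ i : Fin n, F.IsEvenIndex i ∧ i.val + (m + 1) = n
    · obtain ⟨i, hi, him⟩ := hex
      obtain ⟨j, rfl, hy⟩ := F.exists_hi_of_isEvenIndex hi
      have hjm : j.val + 1 + (m + 1) = n := him
      -- The left neighbour corrects the value at `hi j`. Its only other effect is at index `j - 1`,
      -- which is not yet treated.
      refine ⟨α + Pi.single (TDGroup.lo j)
        ((u (TDGroup.hi j) - F.coad α (TDGroup.hi j)) / F.y j), ?_, ?_⟩
      · intro k hk
        rw [Pi.add_apply, h1 k hk, Pi.single_eq_of_ne, add_zero]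
        rintro rfl
        exact (F.isEvenIndex_hi hy).1 hi hk
      · intro k hk hkm
        rw [map_add, Pi.add_apply]
        by_cases hkj : k = TDGroup.hi j
        · subst hkj
          rw [F.coad_hi (α := Pi.single _ _) j, Pi.single_eq_same, div_mul_cancel₀ _ hy, add_sub_cancel]
          intro l hl _
          rw [Pi.single_eq_of_ne]
          intro h'
          have e1 : l.val = j.val + 1 := congrArg Fin.val hl
          have e2 : l.val + 1 = j.val := congrArg Fin.val h'
          omega
        · have hne : k.val ≠ j.val + 1 := fun h => hkj (Fin.ext h)
          rw [h2 k hk (by omega), add_eq_left, ← Pi.zero_apply (M := fun _ => K) k,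
            ← map_zero F.coad]
          refine F.coad_congr (fun l hl _ => ?_) (fun l hl _ => ?_)
          · rw [Pi.single_eq_of_ne, Pi.zero_apply]
            intro h'
            have e1 : l.val + 1 = k.val := congrArg Fin.val hl
            have e2 : (TDGroup.lo l).val = (TDGroup.lo j).val := congrArg Fin.val h'
            change l.val = j.val at e2
            omega
          · rw [Pi.single_eq_of_ne, Pi.zero_apply]
            intro h'
            have e1 : l.val = k.val := congrArg Fin.val hl
            have e2 : l.val + 1 = j.val := congrArg Fin.val h'
            omega
    · exact ⟨α, h1, fun i hi him => h2 i hi (by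
        have : i.val + (m + 1) ≠ n := fun h => hex ⟨i, hi, h⟩
        omega)⟩

/-- The indices with an even (1-based) position in their block. -/
abbrev EvenPos (F : TDDual n K) := {i : Fin n // F.IsEvenIndex i}

open Classical in
/-- Extension by zero of a function on the even positions. -/
noncomputable def extendEven (F : TDDual n K) : (F.EvenPos → K) →ₗ[K] (Fin n → K) where
  toFun t i := if h : F.IsEvenIndex i then t ⟨i, h⟩ else 0
  map_add' t t' := by
    funext i
    by_cases h : F.IsEvenIndex i <;> simp [h]
  map_smul' c t := by
    funext i
    by_cases h : F.IsEvenIndex i <;> simp [h]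

lemma extendEven_of_even (F : TDDual n K) (t : F.EvenPos → K) {i : Fin n} (h : F.IsEvenIndex i) :
    F.extendEven t i = t ⟨i, h⟩ := dif_pos h

lemma extendEven_of_odd (F : TDDual n K) (t : F.EvenPos → K) {i : Fin n}
    (h : ¬ F.IsEvenIndex i) : F.extendEven t i = 0 := dif_neg h

lemma extendEven_injective (F : TDDual n K) : Function.Injective F.extendEven := by
  intro t t' h
  funext i
  rw [← F.extendEven_of_even t i.2, h, F.extendEven_of_even t' i.2]

/-- The non-free odd positions are at most as many as the even ones. -/
lemma card_constrained_le (F : TDDual n K) :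
    Nat.card {i : Fin n // ¬ F.IsEvenIndex i ∧ ¬ F.IsFreeIndex i} ≤ Nat.card F.EvenPos := by
  have key : ∀ i : Fin n, ¬ F.IsEvenIndex i ∧ ¬ F.IsFreeIndex i → ∃ k, F.IsEvenIndex k ∧
      (F.InOddBlock k ↔ F.InOddBlock i) ∧ (F.InOddBlock i → k.val + 1 = i.val) ∧
      (¬ F.InOddBlock i → k.val = i.val + 1) := by
    -- A constrained position is matched with its left neighbour in an odd block and its right
    -- neighbour in an even one. The match preserves the parity of the block size, so the two rules
    -- cannot collide.
    rintro i ⟨h1, h2⟩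
    by_cases hO : F.InOddBlock i
    · have h0 : i.val ≠ 0 := fun h => h2 ⟨invEmbedding_of_val_eq_zero _ h, hO⟩
      obtain ⟨j, rfl⟩ : ∃ j : Fin (n - 1), TDGroup.hi j = i :=
        ⟨⟨i.val - 1, by omega⟩, Fin.ext (show i.val - 1 + 1 = i.val by omega)⟩
      have hy : F.y j ≠ 0 := fun h => h2 ⟨(F.partition_cut h).1, hO⟩
      exact ⟨TDGroup.lo j, by_contra fun h => h1 ((F.isEvenIndex_hi hy).2 h),
        (F.inOddBlock_hi hy).symm, fun _ => rfl, fun h => absurd hO h⟩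
    · obtain ⟨j, rfl, hy⟩ := F.exists_lo_of_inOddBlock (i := i) (by tauto)
      exact ⟨TDGroup.hi j, (F.isEvenIndex_hi hy).2 h1, F.inOddBlock_hi hy,
        fun h => absurd h hO, fun _ => rfl⟩
  choose! f hf1 hf2 hf3 hf4 using key
  refine Nat.card_le_card_of_injective (fun i => ⟨f i, hf1 i i.2⟩) fun i k hik => ?_
  have hik' : f i = f k := congrArg Subtype.val hik
  have hik'' : (f i).val = (f k).val := congrArg Fin.val hik'
  have hO : F.InOddBlock i ↔ F.InOddBlock k := by rw [← hf2 i i.2, hik', hf2 k k.2]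
  refine Subtype.ext (Fin.ext ?_)
  by_cases h : F.InOddBlock i
  · have := hf3 i i.2 h
    have := hf3 k k.2 (hO.1 h)
    omega
  · have := hf4 i i.2 h
    have := hf4 k k.2 (fun h' => h (hO.2 h'))
    omega

lemma exists_coad_eq_on_constrained (F : TDDual n K) (u : Fin n → K) :
    ∃ α : Fin n → K, (∀ i, ¬ F.IsEvenIndex i → α i = 0) ∧
      ∀ i, ¬ F.IsEvenIndex i → ¬ F.IsFreeIndex i → F.coad α i = u i := by
  classical
  let D := {i : Fin n // ¬ F.IsEvenIndex i ∧ ¬ F.IsFreeIndex i}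
  let L : (F.EvenPos → K) →ₗ[K] (D → K) :=
    (LinearMap.funLeft K K (Subtype.val : D → Fin n)) ∘ₗ F.coad ∘ₗ F.extendEven
  have hL : ∀ t d, L t d = F.coad (F.extendEven t) d.1 := fun _ _ => rfl
  have hinj : Function.Injective L := by
    rw [← LinearMap.ker_eq_bot, LinearMap.ker_eq_bot']
    intro t ht
    apply F.extendEven_injective
    rw [map_zero]
    refine F.eq_zero_of_coad_eq_zero (fun i hi => F.extendEven_of_odd t hi) fun i h1 h2 => ?_
    rw [← hL t ⟨i, h1, h2⟩, ht, Pi.zero_apply]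
  have hle : Module.finrank K (F.EvenPos → K) ≤ Module.finrank K (D → K) :=
    LinearMap.finrank_le_finrank_of_injective hinj
  -- Injectivity gives one inequality and the matching of positions the other; an injective map
  -- between spaces of equal dimension is onto.
  have hcard : Module.finrank K (F.EvenPos → K) = Module.finrank K (D → K) := by
    refine le_antisymm hle ?_
    rw [Module.finrank_fintype_fun_eq_card, Module.finrank_fintype_fun_eq_card,
      ← Nat.card_eq_fintype_card, ← Nat.card_eq_fintype_card]
    exact F.card_constrained_le
  obtain ⟨t, ht⟩ := (LinearMap.injective_iff_surjective_of_finrank_eq_finrank hcard).1 hinj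
    (fun d => u d.1)
  refine ⟨F.extendEven t, fun i hi => F.extendEven_of_odd t hi, fun i h1 h2 => ?_⟩
  rw [← hL t ⟨i, h1, h2⟩, ht]

end TDDual

/-! ### Orbits: standard representatives, dimension and cardinality -/

namespace TDDual

variable {n : ℕ} {K : Type*} [Field K]

lemma mem_orbit_iff {F F' : TDDual n K} :
    F' ∈ MulAction.orbit (TDGroup n K) F ↔
      F'.y = F.y ∧ ∃ α : Fin n → K, ∀ i, F'.x i = F.x i + F.coad α i := by
  constructor
  · rintro ⟨g, rfl⟩
    exact ⟨rfl, g.α, fun i => smul_x_eq g F i⟩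
  · rintro ⟨hy, α, hα⟩
    exact ⟨⟨α, 0⟩, TDDual.ext (fun i => by rw [smul_x_eq, hα i]) fun j => by
      rw [hy]; rfl⟩

lemma partition_congr {F F' : TDDual n K} (hy : F'.y = F.y) : F'.partition = F.partition := by
  rw [partition, partition, hy]

lemma isEvenIndex_congr {F F' : TDDual n K} (hy : F'.y = F.y) :
    F'.IsEvenIndex = F.IsEvenIndex := by
  unfold IsEvenIndex
  rw [partition_congr hy]

lemma isFreeIndex_congr {F F' : TDDual n K} (hy : F'.y = F.y) :
    F'.IsFreeIndex = F.IsFreeIndex := by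
  unfold IsFreeIndex InOddBlock
  rw [partition_congr hy]

lemma mem_orbit_of_eq_on_odd {F F' : TDDual n K} (hy : F'.y = F.y)
    (hx : ∀ i, ¬ F.IsEvenIndex i → F'.x i = F.x i) :
    F' ∈ MulAction.orbit (TDGroup n K) F := by
  obtain ⟨α, h1, h2⟩ := F.exists_coad_eq_on_even (fun i => F'.x i - F.x i)
  refine mem_orbit_iff.2 ⟨hy, α, fun i => ?_⟩
  by_cases hi : F.IsEvenIndex i
  · rw [h2 i hi, add_sub_cancel]
  · rw [F.coad_eq_zero_of_odd h1 hi, add_zero, hx i hi]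

lemma isStandard_iff_isFreeIndex (F : TDDual n K) :
    F.IsStandard ↔ ∀ i, ¬ F.IsFreeIndex i → F.x i = 0 := by
  rw [isStandard_iff]
  exact forall_congr' fun i => not_imp_comm

lemma exists_isStandard_mem_orbit (F : TDDual n K) :
    ∃ F' ∈ MulAction.orbit (TDGroup n K) F, F'.IsStandard := by
  classical
  obtain ⟨α, h1, h2⟩ := F.exists_coad_eq_on_constrained (fun i => - F.x i)
  let F' : TDDual n K := (fun i => if F.IsEvenIndex i then 0 else F.x i + F.coad α i, F.y)
  have hF' : ∀ i, F'.x i = if F.IsEvenIndex i then 0 else F.x i + F.coad α i := fun _ => rfl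
  obtain ⟨β, h3, h4⟩ := F.exists_coad_eq_on_even (fun i => - F.x i)
  -- `α` lives on even positions and changes only odd entries, `β` the reverse, so the two
  -- corrections do not interfere.
  refine ⟨F', mem_orbit_iff.2 ⟨rfl, α + β, fun i => ?_⟩, ?_⟩
  · rw [hF', map_add, Pi.add_apply]
    split_ifs with hi
    · rw [F.coad_eq_zero_of_even h1 hi, h4 i hi]
      ring
    · rw [F.coad_eq_zero_of_odd h3 hi, add_zero]
  · rw [isStandard_iff_isFreeIndex, isFreeIndex_congr (rfl : F'.y = F.y)]
    intro i hi
    rw [hF']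
    split_ifs with he
    · rfl
    · rw [h2 i he hi, add_neg_cancel]

lemma IsStandard.eq_of_mem_orbit {F F' : TDDual n K} (hF : F.IsStandard) (hF' : F'.IsStandard)
    (h : F' ∈ MulAction.orbit (TDGroup n K) F) : F' = F := by
  obtain ⟨hy, α, hα⟩ := mem_orbit_iff.1 h
  rw [isStandard_iff_isFreeIndex] at hF hF'
  rw [isFreeIndex_congr hy] at hF'
  -- Odd entries of `α` do not affect the displacement at odd positions, so they may be dropped
  -- there.
  let β := F.extendEven fun i => α i
  have hβ : ∀ i, ¬ F.IsEvenIndex i → F.coad α i = F.coad β i := by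
    intro i hi
    rw [← sub_eq_zero, ← Pi.sub_apply, ← map_sub]
    refine F.coad_eq_zero_of_odd (fun k hk => ?_) hi
    rw [Pi.sub_apply, sub_eq_zero]
    exact (F.extendEven_of_even (fun i => α i.1) hk).symm
  have hβ0 : β = 0 := by
    refine F.eq_zero_of_coad_eq_zero (fun i hi => F.extendEven_of_odd _ hi) fun i h1 h2 => ?_
    have := hα i
    rw [hF i h2, hF' i h2, zero_add] at this
    rw [← hβ i h1, ← this]
  refine TDDual.ext (fun i => ?_) fun j => by rw [hy]
  by_cases hi : F.IsEvenIndex i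
  · have h2 : ¬ F.IsFreeIndex i := fun h => F.not_isEvenIndex_of_isFreeIndex h hi
    rw [hF i h2, hF' i h2]
  · rw [hα i, hβ i hi, hβ0, map_zero, Pi.zero_apply, add_zero]

lemma finrank_range_coad (F : TDDual n K) :
    Module.finrank K (LinearMap.range F.coad) = 2 * Nat.card F.EvenPos := by
  classical
  -- The range splits as the injective image of the even-supported vectors plus all vectors
  -- supported on even positions, which gives the factor 2.
  let Φ : ((F.EvenPos → K) × (F.EvenPos → K)) →ₗ[K] (Fin n → K) :=
    (F.coad ∘ₗ F.extendEven).coprod F.extendEven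
  have hΦ : ∀ p, Φ p = F.coad (F.extendEven p.1) + F.extendEven p.2 := fun _ => rfl
  have hinj : Function.Injective Φ := by
    rw [← LinearMap.ker_eq_bot, LinearMap.ker_eq_bot']
    rintro ⟨t, u⟩ h
    rw [hΦ] at h
    have ht : t = 0 := by
      apply F.extendEven_injective
      rw [map_zero]
      refine F.eq_zero_of_coad_eq_zero (fun i hi => F.extendEven_of_odd t hi) fun i h1 _ => ?_
      have := congrFun h i
      rwa [Pi.add_apply, F.extendEven_of_odd _ h1, add_zero] at this
    subst ht
    rw [map_zero, map_zero, zero_add] at h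
    exact Prod.ext rfl (F.extendEven_injective (h.trans (map_zero _).symm))
  have hrange : LinearMap.range F.coad = LinearMap.range Φ := by
    apply le_antisymm
    · rintro _ ⟨α, rfl⟩
      refine ⟨(fun i => α i, fun i => F.coad α i), ?_⟩
      rw [hΦ]
      funext i
      rw [Pi.add_apply]
      by_cases hi : F.IsEvenIndex i
      · rw [F.coad_eq_zero_of_even (fun k hk => F.extendEven_of_odd _ hk) hi,
          F.extendEven_of_even _ hi, zero_add]
      · rw [F.extendEven_of_odd _ hi, add_zero, ← sub_eq_zero, ← Pi.sub_apply, ← map_sub]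
        refine F.coad_eq_zero_of_odd (fun k hk => ?_) hi
        rw [Pi.sub_apply, F.extendEven_of_even _ hk, sub_self]
    · rintro _ ⟨⟨t, u⟩, rfl⟩
      rw [hΦ]
      refine Submodule.add_mem _ ⟨_, rfl⟩ ?_
      obtain ⟨α, h1, h2⟩ := F.exists_coad_eq_on_even (F.extendEven u)
      refine ⟨α, funext fun i => ?_⟩
      by_cases hi : F.IsEvenIndex i
      · exact h2 i hi
      · rw [F.coad_eq_zero_of_odd h1 hi, F.extendEven_of_odd _ hi]
  rw [hrange, LinearMap.finrank_range_of_inj hinj, Module.finrank_prod,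
    Module.finrank_fintype_fun_eq_card, ← Nat.card_eq_fintype_card, two_mul]

/-- The inclusion of the first subdiagonal. -/
def inlX (n : ℕ) (K : Type*) [Field K] : (Fin n → K) →ₗ[K] TDDual n K :=
  LinearMap.inl K (Fin n → K) (Fin (n - 1) → K)

lemma inlX_injective : Function.Injective (inlX n K) := fun _ _ h => congrArg Prod.fst h

lemma orbit_eq (F : TDDual n K) :
    MulAction.orbit (TDGroup n K) F =
      AffineSubspace.mk' F ((LinearMap.range F.coad).map (inlX n K)) := by
  ext F'
  rw [SetLike.mem_coe, AffineSubspace.mem_mk', vsub_eq_sub, mem_orbit_iff]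
  constructor
  · rintro ⟨hy, α, hα⟩
    refine ⟨F.coad α, ⟨α, rfl⟩, ?_⟩
    refine TDDual.ext (fun i => ?_) (fun j => ?_)
    · show F.coad α i = F'.x i - F.x i
      rw [hα i, add_sub_cancel_left]
    · show (0 : K) = F'.y j - F.y j
      rw [hy, sub_self]
  · rintro ⟨_, ⟨α, rfl⟩, h⟩
    refine ⟨funext fun j => ?_, α, fun i => ?_⟩
    · have : (0 : K) = F'.y j - F.y j := congrFun (congrArg TDDual.y h) j
      exact (sub_eq_zero.1 this.symm)
    · have : F.coad α i = F'.x i - F.x i := congrFun (congrArg TDDual.x h) i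
      rw [this, add_sub_cancel]

lemma finrank_map_range_coad (F : TDDual n K) :
    Module.finrank K ((LinearMap.range F.coad).map (inlX n K)) = 2 * Nat.card F.EvenPos := by
  rw [← F.finrank_range_coad]
  exact (Submodule.equivMapOfInjective _ inlX_injective _).symm.finrank_eq

lemma finrank_vectorSpan_orbit (F : TDDual n K) :
    Module.finrank K (vectorSpan K (MulAction.orbit (TDGroup n K) F)) =
      2 * Nat.card F.EvenPos := by
  rw [orbit_eq, ← AffineSubspace.direction_eq_vectorSpan, AffineSubspace.direction_mk',
    finrank_map_range_coad]

lemma card_orbit [Fintype K] (F : TDDual n K) :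
    Nat.card (MulAction.orbit (TDGroup n K) F) = Fintype.card K ^ (2 * Nat.card F.EvenPos) := by
  have hmem : ∀ F', F' ∈ MulAction.orbit (TDGroup n K) F ↔
      F' - F ∈ (LinearMap.range F.coad).map (inlX n K) := fun F' => by
    rw [orbit_eq, SetLike.mem_coe, AffineSubspace.mem_mk', vsub_eq_sub]
  have e : MulAction.orbit (TDGroup n K) F ≃ (LinearMap.range F.coad).map (inlX n K) :=
    { toFun := fun F' => ⟨F'.1 - F, (hmem _).1 F'.2⟩
      invFun := fun v => ⟨v.1 + F, (hmem _).2 (by rw [add_sub_cancel_right]; exact v.2)⟩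
      left_inv := fun F' => Subtype.ext (sub_add_cancel _ _)
      right_inv := fun v => Subtype.ext (add_sub_cancel_right _ _) }
  have : Finite ((LinearMap.range F.coad).map (inlX n K)) :=
    inferInstanceAs (Finite (Set.Elem _))
  rw [Nat.card_congr e, Module.natCard_eq_pow_finrank (K := K), finrank_map_range_coad,
    Nat.card_eq_fintype_card]

end TDDual

/-! ### Counting the group, the dual space and the orbits -/

lemma TDDual.card_eq {n : ℕ} {K : Type*} [Fintype K] (hn : 1 ≤ n) : Nat.card (TDDual n K) = Fintype.card K ^ (2 * n - 1) := by
  have : Nat.card (TDDual n K) = Nat.card ((Fin n → K) × (Fin (n - 1) → K)) := rfl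
  rw [this, Nat.card_prod, Nat.card_fun, Nat.card_fun, Nat.card_eq_fintype_card,
    Nat.card_fin, Nat.card_fin, ← pow_add]
  congr 1
  omega

lemma TDGroup.card_eq {n : ℕ} {K : Type*} [Field K] :
    Nat.card (TDGroup n K) = Nat.card (TDDual n K) :=
  Nat.card_congr
    { toFun := fun g => ((g.α, g.β) : TDDual n K)
      invFun := fun F => ⟨F.x, F.y⟩
      left_inv := fun _ => rfl
      right_inv := fun _ => rfl }

lemma CoadjointOrbit.sum_card_orbit {n : ℕ} {K : Type*} [Field K] [Finite K] :
    ∑ Ω : CoadjointOrbit n K, Nat.card Ω.orbit = Nat.card (TDDual n K) := by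
  rw [Nat.card_congr (MulAction.selfEquivSigmaOrbits' (TDGroup n K) (TDDual n K)), Nat.card_sigma]

/-! ### The polarization and the induced model -/

lemma AddChar.apply_sum_eq_prod {A M ι : Type*} [AddCommMonoid A] [CommMonoid M]
    (e : AddChar A M) (s : Finset ι) (f : ι → A) : e (∑ i ∈ s, f i) = ∏ i ∈ s, e (f i) := by
  classical
  induction s using Finset.induction_on with
  | empty => simp
  | insert i s hi ih => rw [Finset.sum_insert hi, Finset.prod_insert hi, e.map_add_eq_mul, ih]

namespace TDDual

variable {n : ℕ} {K : Type*} [Field K]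

/-- The polarization attached to `F`: the entries of `α` in even positions vanish. -/
def polar (F : TDDual n K) : Subgroup (TDGroup n K) where
  carrier := {h | ∀ i, F.IsEvenIndex i → h.α i = 0}
  mul_mem' ha hb i hi := by simp [ha i hi, hb i hi]
  one_mem' i _ := by simp
  inv_mem' ha i hi := by simp [ha i hi]

lemma mem_polar {F : TDDual n K} {h : TDGroup n K} :
    h ∈ F.polar ↔ ∀ i, F.IsEvenIndex i → h.α i = 0 := Iff.rfl

lemma polar_congr {F F' : TDDual n K} (hy : F'.y = F.y) : F'.polar = F.polar := by
  ext h
  rw [mem_polar, mem_polar, isEvenIndex_congr hy]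

lemma traceForm_mul_of_mem_polar (F : TDDual n K) {h h' : TDGroup n K} (hh : h ∈ F.polar)
    (hh' : h' ∈ F.polar) : F.traceForm (h * h') = F.traceForm h + F.traceForm h' := by
  have key : ∀ j : Fin (n - 1), F.y j * (h.α (TDGroup.lo j) * h'.α (TDGroup.hi j)) = 0 := by
    intro j
    by_cases hy : F.y j = 0
    · rw [hy, zero_mul]
    · by_cases hj : F.IsEvenIndex (TDGroup.lo j)
      · rw [hh _ hj, zero_mul, mul_zero]
      · rw [hh' _ ((F.isEvenIndex_hi hy).2 hj), mul_zero, mul_zero]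
  simp only [traceForm, TDGroup.mul_α, TDGroup.mul_β, key, add_zero, mul_add,
    Finset.sum_add_distrib]
  ring

/-- Conjugating the character by `g` is the coadjoint action on `F`; this ties orbits to
representations. -/
lemma traceForm_conj (F : TDDual n K) (g h : TDGroup n K) :
    F.traceForm (g * h * g⁻¹) = (g • F).traceForm h := by
  have h1 : (g • F).traceForm h = F.pairing (g.adjoint (h.α, h.β)) :=
    pairing_smul g F (h.α, h.β)
  rw [h1, traceForm, pairing]
  congr 1
  · refine Finset.sum_congr rfl fun i _ => ?_
    simp [TDGroup.adjoint]
  · refine Finset.sum_congr rfl fun j _ => ?_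
    simp only [TDGroup.adjoint, TDGroup.mul_α, TDGroup.mul_β, TDGroup.inv_α, TDGroup.inv_β]
    ring

/-- The representative of the coset of the polarization with coordinates `t`. -/
noncomputable def cosetRep (F : TDDual n K) (t : F.EvenPos → K) : TDGroup n K :=
  ⟨F.extendEven t, fun _ => 0⟩

/-- The right action on cosets of the polarization. -/
def cosetShift (F : TDDual n K) (t : F.EvenPos → K) (g : TDGroup n K) : F.EvenPos → K :=
  fun i => t i + g.α i

/-- The cocycle of the action on cosets of the polarization. -/
noncomputable def cocycle (F : TDDual n K) (t : F.EvenPos → K) (g : TDGroup n K) : TDGroup n K :=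
  F.cosetRep t * g * (F.cosetRep (F.cosetShift t g))⁻¹

lemma cosetRep_zero (F : TDDual n K) : F.cosetRep 0 = 1 := by
  ext i
  · simp [cosetRep]
  · rfl

lemma cocycle_mul_cosetRep (F : TDDual n K) (t : F.EvenPos → K) (g : TDGroup n K) :
    F.cocycle t g * F.cosetRep (F.cosetShift t g) = F.cosetRep t * g := by
  simp [cocycle]

lemma cocycle_mem (F : TDDual n K) (t : F.EvenPos → K) (g : TDGroup n K) :
    F.cocycle t g ∈ F.polar := by
  intro i hi
  simp [cocycle, cosetRep, extendEven_of_even _ _ hi, cosetShift]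

lemma cosetShift_of_mem_polar (F : TDDual n K) (t : F.EvenPos → K) {h : TDGroup n K}
    (hh : h ∈ F.polar) : F.cosetShift t h = t := by
  funext i
  rw [cosetShift, hh i i.2, add_zero]

lemma traceForm_cocycle_of_mem_polar (F : TDDual n K) (t : F.EvenPos → K) {h : TDGroup n K}
    (hh : h ∈ F.polar) : F.traceForm (F.cocycle t h) = (F.cosetRep t • F).traceForm h := by
  rw [cocycle, F.cosetShift_of_mem_polar t hh, traceForm_conj]

lemma isEvenIndex_embedding (F : TDDual n K) (r : Fin F.partition.length)
    (i : Fin (F.partition.blocksFun r)) :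
    F.IsEvenIndex (F.partition.embedding r i) ↔ Even (i.val + 1) := by
  rw [IsEvenIndex, F.partition.invEmbedding_comp]

/-- The even positions of the blocks are the even positions of `F`. -/
noncomputable def evenPosEquiv (F : TDDual n K) :
    (Σ r : Fin F.partition.length, EvenIndex (F.partition.blocksFun r)) ≃ F.EvenPos :=
  Equiv.ofBijective
    (fun p => ⟨F.partition.embedding p.1 p.2, (F.isEvenIndex_embedding _ _).2 p.2.2⟩) <| by
    constructor
    · rintro ⟨r, i, hi⟩ ⟨r', i', hi'⟩ h
      have h' : F.partition.blocksFinEquiv ⟨r, i⟩ = F.partition.blocksFinEquiv ⟨r', i'⟩ :=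
        congrArg Subtype.val h
      obtain ⟨rfl, h''⟩ := Sigma.mk.inj_iff.1 (F.partition.blocksFinEquiv.injective h')
      obtain rfl := eq_of_heq h''
      rfl
    · rintro ⟨i, hi⟩
      refine ⟨⟨F.partition.index i, F.partition.invEmbedding i, hi⟩, Subtype.ext ?_⟩
      exact F.partition.embedding_comp_inv i

/-- A function on the even positions of `F` as a family of functions on those of the blocks. -/
noncomputable def splitEquiv (F : TDDual n K) :
    (F.EvenPos → K) ≃ ((r : Fin F.partition.length) → EvenIndex (F.partition.blocksFun r) → K) :=
  (Equiv.arrowCongr F.evenPosEquiv.symm (Equiv.refl K)).trans 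
    (Equiv.piCurry fun _ _ => K)

lemma splitEquiv_apply (F : TDDual n K) (t : F.EvenPos → K) (r : Fin F.partition.length)
    (i : EvenIndex (F.partition.blocksFun r)) :
    F.splitEquiv t r i =
      t ⟨F.partition.embedding r i, (F.isEvenIndex_embedding _ _).2 i.2⟩ := rfl

lemma proj_cosetRep (F : TDDual n K) (t : F.EvenPos → K) (r : Fin F.partition.length) :
    TDGroup.proj F.partition (F.cosetRep t) r = TDGroup.sec (F.splitEquiv t r) := by
  ext i
  · show F.extendEven t (F.partition.embedding r i) = _
    show _ = if h : Even (i.val + 1) then F.splitEquiv t r ⟨i, h⟩ else 0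
    by_cases hi : Even (i.val + 1)
    · rw [F.extendEven_of_even _ ((F.isEvenIndex_embedding r i).2 hi), dif_pos hi,
        splitEquiv_apply]
    · rw [F.extendEven_of_odd _ (fun h => hi ((F.isEvenIndex_embedding r i).1 h)), dif_neg hi]
  · rfl

lemma proj_cocycle (F : TDDual n K) (t : F.EvenPos → K) (g : TDGroup n K)
    (r : Fin F.partition.length) :
    TDGroup.proj F.partition (F.cocycle t g) r =
      TDGroup.master (F.splitEquiv t r) (TDGroup.proj F.partition g r) := by
  rw [cocycle, map_mul, map_mul, map_inv, Pi.mul_apply, Pi.mul_apply, Pi.inv_apply,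
    proj_cosetRep, proj_cosetRep]
  rfl

lemma blockPos_injective (c : Composition n) :
    Function.Injective fun p : Σ r : Fin c.length, Fin (c.blocksFun r - 1) =>
      c.blockPos p.1 p.2 := by
  rintro ⟨r, p⟩ ⟨r', p'⟩ h
  have h' : c.blocksFinEquiv ⟨r, TDGroup.lo p⟩ = c.blocksFinEquiv ⟨r', TDGroup.lo p'⟩ :=
    Fin.ext (congrArg Fin.val h :)
  obtain ⟨rfl, h''⟩ := Sigma.mk.inj_iff.1 (c.blocksFinEquiv.injective h')
  obtain rfl : p = p' := Fin.ext (congrArg Fin.val (eq_of_heq h'') :)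
  rfl

lemma exists_blockPos_eq (F : TDDual n K) {j : Fin (n - 1)} (hy : F.y j ≠ 0) :
    ∃ r p, F.partition.blockPos r p = j := by
  obtain ⟨h1, h2⟩ := F.partition_step hy
  have h3 := (F.partition.invEmbedding (TDGroup.hi j)).isLt
  have h4 : F.partition.blocksFun (F.partition.index (TDGroup.hi j)) =
    F.partition.blocksFun (F.partition.index (TDGroup.lo j)) := by rw [h1]
  refine ⟨F.partition.index (TDGroup.lo j),
    ⟨(F.partition.invEmbedding (TDGroup.lo j)).val, by omega⟩, Fin.ext ?_⟩
  exact (congrArg Fin.val (F.partition.embedding_comp_inv (TDGroup.lo j)) :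
    F.partition.sizeUpTo _ + (F.partition.invEmbedding (TDGroup.lo j)).val = j.val)

lemma traceForm_eq_sum_block (F : TDDual n K) (g : TDGroup n K) :
    F.traceForm g =
      ∑ r, (F.block F.partition r).traceForm (TDGroup.proj F.partition g r) := by
  simp only [traceForm, Finset.sum_add_distrib]
  congr 1
  · exact (F.partition.sum_sum_apply_embedding (a := fun i => F.x i * g.α i)).symm
  · rw [← Fintype.sum_sigma']
    symm
    -- The projection forgets `β` at the cuts, but there `y` vanishes and no term is lost.
    refine Fintype.sum_of_injective
      (fun p : Σ r : Fin F.partition.length, Fin (F.partition.blocksFun r - 1) =>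
        F.partition.blockPos p.1 p.2) (blockPos_injective _) _ _ (fun j hj => ?_) (fun p => rfl)
    by_cases hy : F.y j = 0
    · rw [hy, zero_mul]
    · obtain ⟨r, p, h⟩ := F.exists_blockPos_eq hy
      exact absurd ⟨⟨r, p⟩, h⟩ hj

variable [Fintype K] (e : AddChar K ℂ)

/-- The representation space of `F` as a space of functions on the cosets of the polarization. -/
noncomputable def model (F : TDDual n K) : F.RepSpace ≃ₗ[ℂ] ((F.EvenPos → K) → ℂ) :=
  (Basis.piTensorProduct fun r : Fin F.partition.length =>
      Pi.basisFun ℂ (EvenIndex (F.partition.blocksFun r) → K)).equivFun ≪≫ₗ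
    LinearEquiv.funCongrLeft ℂ ℂ F.splitEquiv

lemma model_tprod (F : TDDual n K)
    (f : (r : Fin F.partition.length) → (EvenIndex (F.partition.blocksFun r) → K) → ℂ)
    (t : F.EvenPos → K) :
    F.model (PiTensorProduct.tprod ℂ f) t = ∏ r, f r (F.splitEquiv t r) := by
  rw [model, LinearEquiv.trans_apply, LinearEquiv.funCongrLeft_apply, LinearMap.funLeft_apply,
    Module.Basis.equivFun_apply, Basis.piTensorProduct_repr_tprod_apply]
  simp

lemma model_orbitRep (F : TDDual n K) (g : TDGroup n K) (v : F.RepSpace) (t : F.EvenPos → K) :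
    F.model (F.orbitRep e g v) t =
      e (F.traceForm (F.cocycle t g)) * F.model v (F.cosetShift t g) := by
  induction v using PiTensorProduct.induction_on with
  | smul_tprod c f =>
    have h1 : F.orbitRep e g (PiTensorProduct.tprod ℂ f) = PiTensorProduct.tprod ℂ fun r =>
        (F.block F.partition r).basicRep e (TDGroup.proj F.partition g r) (f r) :=
      PiTensorProduct.map_tprod _ _
    have h2 : e (F.traceForm (F.cocycle t g)) =
        ∏ r, e ((F.block F.partition r).traceForm
          (TDGroup.master (F.splitEquiv t r) (TDGroup.proj F.partition g r))) := by
      rw [traceForm_eq_sum_block, AddChar.apply_sum_eq_prod]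
      simp only [proj_cocycle]
    rw [map_smul, map_smul, map_smul, h1, Pi.smul_apply, Pi.smul_apply, model_tprod, model_tprod,
      h2, smul_eq_mul, smul_eq_mul, mul_left_comm, ← Finset.prod_mul_distrib]
    rfl
  | add v w hv hw =>
    rw [map_add, map_add, map_add, Pi.add_apply, Pi.add_apply, hv, hw, mul_add]

lemma finrank_repSpace (F : TDDual n K) :
    Module.finrank ℂ F.RepSpace = Fintype.card K ^ Nat.card F.EvenPos := by
  classical
  rw [F.model.finrank_eq, Module.finrank_fintype_fun_eq_card, Fintype.card_fun,
    Nat.card_eq_fintype_card]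

end TDDual

/-! ### Separation by characters and Fourier inversion -/

lemma AddChar.eq_of_forall_apply_mul_eq {K : Type*} [Field K] {e : AddChar K ℂ} (he : e ≠ 1)
    {a b : K} (h : ∀ c, e (a * c) = e (b * c)) : a = b := by
  by_contra hab
  refine he (AddChar.eq_one_iff.2 fun c => ?_)
  have hab' : a - b ≠ 0 := sub_ne_zero.2 hab
  have h1 := h ((a - b)⁻¹ * c)
  have h2 : c = a * ((a - b)⁻¹ * c) - b * ((a - b)⁻¹ * c) := by field_simp
  rw [h2, AddChar.map_sub_eq_div, h1, div_self]
  exact (e.val_isUnit _).ne_zero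

/-- A function that does not vanish at the origin has a non-zero Fourier coefficient. -/
lemma AddChar.exists_fourier_ne_zero {K ι : Type*} [Field K] [Fintype K] [Fintype ι]
    [DecidableEq ι] {e : AddChar K ℂ} (he : e ≠ 1) {φ : (ι → K) → ℂ} (hφ : φ 0 ≠ 0) :
    ∃ y : ι → K, ∑ b, e (-∑ i, y i * b i) * φ b ≠ 0 := by
  classical
  by_contra! h
  have hsum : ∀ b : ι → K, ∑ y : ι → K, e (-∑ i, y i * b i) =
      if b = 0 then (Fintype.card (ι → K) : ℂ) else 0 := by
    intro b
    let ψ : AddChar (ι → K) ℂ :=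
      { toFun := fun y => e (-∑ i, y i * b i)
        map_zero_eq_one' := by simp
        map_add_eq_mul' := fun y y' => by
          rw [← AddChar.map_add_eq_mul, ← neg_add, ← Finset.sum_add_distrib]
          simp only [Pi.add_apply, add_mul] }
    split_ifs with hb
    · simp [hb]
    · refine AddChar.sum_eq_zero_iff_ne_zero (ψ := ψ).2 fun hψ => hb (funext fun i => ?_)
      refine AddChar.eq_of_forall_apply_mul_eq he fun c => ?_
      have h1 : ψ (Pi.single i (-c)) = 1 := by rw [hψ]; rfl
      have h2 : ψ (Pi.single i (-c)) = e (-∑ k, (Pi.single i (-c) : ι → K) k * b k) := rfl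
      rw [Finset.sum_eq_single i (fun k _ hk => by rw [Pi.single_eq_of_ne hk, zero_mul])
        (fun hi => absurd (Finset.mem_univ i) hi), Pi.single_eq_same, neg_mul, neg_neg, h1] at h2
      rw [Pi.zero_apply, zero_mul, AddChar.map_zero_eq_one, mul_comm, ← h2]
  -- Fourier inversion at the origin: the coefficients sum to a non-zero multiple of `φ 0`.
  have key : ∑ y : ι → K, ∑ b, e (-∑ i, y i * b i) * φ b = Fintype.card (ι → K) * φ 0 := by
    rw [Finset.sum_comm]
    simp only [← Finset.sum_mul, hsum, ite_mul, zero_mul, Finset.sum_ite_eq', Finset.mem_univ,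
      if_true]
  rw [Finset.sum_eq_zero fun y _ => h y] at key
  exact mul_ne_zero (Nat.cast_ne_zero.2 Fintype.card_ne_zero) hφ key.symm

/-! ### Eigenfunctionals of the polarization -/

namespace TDDual

variable {n : ℕ} {K : Type*} [Field K] {e : AddChar K ℂ}

lemma y_eq_of_char_eq (he : e ≠ 1) {F F' : TDDual n K}
    (h : ∀ β : Fin (n - 1) → K, e (F.traceForm ⟨0, β⟩) = e (F'.traceForm ⟨0, β⟩)) :
    F.y = F'.y := by
  classical
  funext j
  refine AddChar.eq_of_forall_apply_mul_eq he fun c => ?_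
  have key : ∀ F : TDDual n K, F.traceForm ⟨0, Pi.single j c⟩ = F.y j * c := fun F => by
    simp [traceForm, Pi.single_apply]
  rw [← key, ← key, h]

lemma x_eq_of_char_eq (he : e ≠ 1) {F F' : TDDual n K} {i : Fin n} (hi : ¬ F.IsEvenIndex i)
    (h : ∀ g ∈ F.polar, e (F.traceForm g) = e (F'.traceForm g)) : F.x i = F'.x i := by
  classical
  refine AddChar.eq_of_forall_apply_mul_eq he fun c => ?_
  have key : ∀ F : TDDual n K, F.traceForm ⟨Pi.single i c, 0⟩ = F.x i * c := fun F => by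
    simp [traceForm, Pi.single_apply]
  rw [← key, ← key]
  refine h _ fun k hk => Pi.single_eq_of_ne ?_ _
  rintro rfl
  exact hi hk

lemma center_mem_polar (F : TDDual n K) (β : Fin (n - 1) → K) : (⟨0, β⟩ : TDGroup n K) ∈ F.polar :=
  fun _ _ => rfl

/-- On odd entries the two functionals differ by `coad` of an even-supported vector, so injectivity
applies. -/
lemma eq_of_char_cosetRep_eq (he : e ≠ 1) (F : TDDual n K) {t t' : F.EvenPos → K}
    (h : ∀ g ∈ F.polar,
      e ((F.cosetRep t • F).traceForm g) = e ((F.cosetRep t' • F).traceForm g)) : t = t' := by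
  apply F.extendEven_injective
  rw [← sub_eq_zero]
  refine F.eq_zero_of_coad_eq_zero (fun i hi => ?_) fun i hi _ => ?_
  · rw [Pi.sub_apply, F.extendEven_of_odd _ hi, F.extendEven_of_odd _ hi, sub_self]
  · have := x_eq_of_char_eq he (F := F.cosetRep t • F) (F' := F.cosetRep t' • F) (i := i) hi h
    rw [smul_x_eq, smul_x_eq, add_right_inj] at this
    rw [map_sub, Pi.sub_apply, sub_eq_zero]
    exact this

/-- `l` is an eigenfunctional of the polarization of `F` with the character attached to `F`. -/
def IsEigenfunctional {V : Type*} [AddCommGroup V] [Module ℂ V]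
    (ρ : Representation ℂ (TDGroup n K) V) (e : AddChar K ℂ) (F : TDDual n K) (l : V →ₗ[ℂ] ℂ) :
    Prop :=
  l ≠ 0 ∧ ∀ h ∈ F.polar, ∀ v, l (ρ h v) = e (F.traceForm h) * l v

section

variable {V W : Type*} [AddCommGroup V] [Module ℂ V] [AddCommGroup W] [Module ℂ W]
  {ρ : Representation ℂ (TDGroup n K) V} {σ : Representation ℂ (TDGroup n K) W}

/-- This makes the choice of representative in an orbit immaterial. -/
lemma IsEigenfunctional.smul {F : TDDual n K} {l : V →ₗ[ℂ] ℂ} (hl : IsEigenfunctional ρ e F l)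
    (g : TDGroup n K) : IsEigenfunctional ρ e (g • F) (l ∘ₗ ρ g) := by
  refine ⟨fun h => hl.1 (LinearMap.ext fun v => ?_), fun h hh v => ?_⟩
  · have := LinearMap.congr_fun h (ρ g⁻¹ v)
    rwa [LinearMap.comp_apply, ρ.self_inv_apply] at this
  · have hmem : g * h * g⁻¹ ∈ F.polar := fun i hi => by
      have : h.α i = 0 := hh i hi
      simp [this]
    rw [← traceForm_conj, LinearMap.comp_apply, LinearMap.comp_apply, ← hl.2 _ hmem,
      ← Module.End.mul_apply, ← Module.End.mul_apply, ← map_mul, ← map_mul, inv_mul_cancel_right]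

lemma IsEigenfunctional.comp_equiv {F : TDDual n K} {l : V →ₗ[ℂ] ℂ}
    (hl : IsEigenfunctional ρ e F l) (φ : σ.Equiv ρ) :
    IsEigenfunctional σ e F (l ∘ₗ φ.toLinearMap) := by
  refine ⟨fun h => hl.1 (LinearMap.ext fun v => ?_), fun h hh v => ?_⟩
  · have := LinearMap.congr_fun h (φ.symm v)
    rw [LinearMap.comp_apply] at this
    rwa [show φ.toLinearMap (φ.symm v) = v from φ.apply_symm_apply v] at this
  · rw [LinearMap.comp_apply, LinearMap.comp_apply, ← hl.2 h hh]
    exact congrArg l (Representation.IntertwiningMap.isIntertwining _ _ φ.toIntertwiningMap h v)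

lemma exists_isEigenfunctional [Fintype K] [Nontrivial V] (he : e ≠ 1)
    (ρ : Representation ℂ (TDGroup n K) V) : ∃ F l, IsEigenfunctional ρ e F l := by
  classical
  obtain ⟨v, hv⟩ := exists_ne (0 : V)
  obtain ⟨l, hl⟩ : ∃ l : Module.Dual ℂ V, l v ≠ 0 := by
    by_contra! h
    exact hv ((Module.forall_dual_apply_eq_zero_iff ℂ v).1 h)
  have h1 : l (ρ 1 v) ≠ 0 := by rwa [map_one]
  obtain ⟨y, hy⟩ := AddChar.exists_fourier_ne_zero he
    (φ := fun β : Fin (n - 1) → K => l (ρ ⟨0, β⟩ v)) h1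
  -- The polarization depends on `y` only, so it is already determined before `x` is found.
  let F₀ : TDDual n K := (0, y)
  have h0 : ∀ i, F₀.IsEvenIndex i → (0 : Fin n → K) i = 0 := fun _ _ => rfl
  obtain ⟨x, hx⟩ := AddChar.exists_fourier_ne_zero he
    (φ := fun α : Fin n → K => if ∀ i, F₀.IsEvenIndex i → α i = 0 then
      ∑ β : Fin (n - 1) → K, e (-∑ i, y i * β i) * l (ρ ⟨α, β⟩ v) else 0)
    (by rw [if_pos h0]; exact hy)
  let F : TDDual n K := (x, y)
  have hF : F.polar = F₀.polar := polar_congr rfl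
  let eqv : (Fin n → K) × (Fin (n - 1) → K) ≃ TDGroup n K :=
    { toFun := fun p => ⟨p.1, p.2⟩
      invFun := fun g => (g.α, g.β)
      left_inv := fun _ => rfl
      right_inv := fun _ => rfl }
  let _ : Fintype (TDGroup n K) := Fintype.ofEquiv _ eqv
  -- Projection of `l` to the eigenspace of the character, up to a scalar; its value at `v` is the
  -- second Fourier coefficient, hence non-zero.
  let l' : V →ₗ[ℂ] ℂ := ∑ h : F.polar, e (-F.traceForm h) • l ∘ₗ ρ h
  have hl' : ∀ w, l' w = ∑ h : F.polar, e (-F.traceForm h) * l (ρ h w) := fun w => by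
    simp [l', LinearMap.sum_apply]
  refine ⟨F, l', fun hl0 => hx ?_, fun g hg w => ?_⟩
  · have h2 := hl' v
    rw [hl0, LinearMap.zero_apply, ← Finset.sum_subtype (Finset.univ.filter (· ∈ F.polar))
      (by simp) (fun h => e (-F.traceForm h) * l (ρ h v)), Finset.sum_filter, ← eqv.sum_comp,
      Fintype.sum_prod_type] at h2
    refine Eq.trans ?_ h2.symm
    refine Finset.sum_congr rfl fun α _ => ?_
    have hmem : ∀ β : Fin (n - 1) → K, eqv (α, β) ∈ F.polar ↔
        ∀ i, F₀.IsEvenIndex i → α i = 0 := fun β => by rw [hF]; rfl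
    simp only [hmem]
    split_ifs
    · rw [Finset.mul_sum]
      refine Finset.sum_congr rfl fun β _ => ?_
      rw [← mul_assoc, ← AddChar.map_add_eq_mul, ← neg_add]
      rfl
    · rw [mul_zero, Finset.sum_const_zero]
  · rw [hl', hl', Finset.mul_sum]
    refine Fintype.sum_equiv (Equiv.mulRight ⟨g, hg⟩) _ _ fun h => ?_
    rw [Equiv.coe_mulRight, Subgroup.coe_mul, F.traceForm_mul_of_mem_polar h.2 hg, neg_add,
      AddChar.map_add_eq_mul, map_mul, Module.End.mul_apply, mul_left_comm, ← mul_assoc,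
      mul_assoc (e (-F.traceForm h)),
      ← AddChar.map_add_eq_mul, neg_add_cancel, AddChar.map_zero_eq_one, mul_one]

end

/-! ### Irreducibility, inequivalence and reciprocity -/

variable [Fintype K]

lemma isEigenfunctional_orbitRep (e : AddChar K ℂ) (F : TDDual n K) :
    IsEigenfunctional (F.orbitRep e) e F (LinearMap.proj 0 ∘ₗ F.model.toLinearMap) := by
  have happ : ∀ v, (LinearMap.proj 0 ∘ₗ F.model.toLinearMap) v = F.model v 0 := fun _ => rfl
  refine ⟨fun h => ?_, fun h hh v => ?_⟩
  · have := LinearMap.congr_fun h (F.model.symm 1)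
    rw [happ, LinearEquiv.apply_symm_apply] at this
    exact one_ne_zero this
  · rw [happ, happ, model_orbitRep, F.traceForm_cocycle_of_mem_polar 0 hh,
      F.cosetShift_of_mem_polar 0 hh, cosetRep_zero, one_smul]

open Classical in
/-- The vectors of the representation corresponding to delta functions. -/
noncomputable def deltaVec (F : TDDual n K) (t : F.EvenPos → K) : F.RepSpace :=
  F.model.symm (Pi.single t 1)

lemma orbitRep_deltaVec (F : TDDual n K) (t : F.EvenPos → K) {h : TDGroup n K}
    (hh : h ∈ F.polar) :
    F.orbitRep e h (F.deltaVec t) = e ((F.cosetRep t • F).traceForm h) • F.deltaVec t := by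
  classical
  apply F.model.injective
  funext s
  rw [model_orbitRep, F.traceForm_cocycle_of_mem_polar s hh, F.cosetShift_of_mem_polar s hh,
    map_smul, Pi.smul_apply, smul_eq_mul, deltaVec, LinearEquiv.apply_symm_apply]
  by_cases hs : s = t
  · rw [hs]
  · rw [Pi.single_eq_of_ne hs, mul_zero, mul_zero]

lemma eq_sum_deltaVec (F : TDDual n K) [Fintype (F.EvenPos → K)] (v : F.RepSpace) :
    v = ∑ t, F.model v t • F.deltaVec t := by
  classical
  apply F.model.injective
  rw [map_sum]
  simp only [map_smul, deltaVec, LinearEquiv.apply_symm_apply]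
  funext s
  simp [Finset.sum_apply, Pi.single_apply]

lemma exists_smul_orbitRep_eq_deltaVec (e : AddChar K ℂ) (F : TDDual n K) (t t' : F.EvenPos → K) :
    ∃ (c : ℂ) (g : TDGroup n K), c • F.orbitRep e g (F.deltaVec t) = F.deltaVec t' := by
  classical
  let g := F.cosetRep (t - t')
  have hg : ∀ s, F.cosetShift s g = t ↔ s = t' := by
    intro s
    have : F.cosetShift s g = s + (t - t') := funext fun i => by
      rw [cosetShift, Pi.add_apply, add_right_inj]
      exact F.extendEven_of_even _ i.2
    rw [this, add_sub_left_comm, add_eq_left, sub_eq_zero]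
  refine ⟨(e (F.traceForm (F.cocycle t' g)))⁻¹, g, F.model.injective (funext fun s => ?_)⟩
  rw [map_smul, Pi.smul_apply, model_orbitRep, smul_eq_mul, deltaVec, deltaVec,
    LinearEquiv.apply_symm_apply, LinearEquiv.apply_symm_apply]
  by_cases hs : s = t'
  · subst hs
    rw [(hg s).2 rfl, Pi.single_eq_same, Pi.single_eq_same, mul_one, inv_mul_cancel₀]
    exact (e.val_isUnit _).ne_zero
  · rw [Pi.single_eq_of_ne hs, Pi.single_eq_of_ne (fun h => hs ((hg s).1 h)), mul_zero, mul_zero]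

lemma IsEigenfunctional.mem_orbit (he : e ≠ 1) {F F' : TDDual n K} {l : F.RepSpace →ₗ[ℂ] ℂ}
    (hl : IsEigenfunctional (F.orbitRep e) e F' l) :
    F' ∈ MulAction.orbit (TDGroup n K) F := by
  classical
  obtain ⟨t, ht⟩ : ∃ t, l (F.deltaVec t) ≠ 0 := by
    by_contra! h
    refine hl.1 (LinearMap.ext fun v => ?_)
    rw [F.eq_sum_deltaVec v, map_sum]
    simp [h]
  have key : ∀ h ∈ F.polar, h ∈ F'.polar →
      e ((F.cosetRep t • F).traceForm h) = e (F'.traceForm h) := fun h h1 h2 => by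
    have := hl.2 h h2 (F.deltaVec t)
    rw [F.orbitRep_deltaVec t h1, map_smul, smul_eq_mul] at this
    exact mul_right_cancel₀ ht this
  -- The central elements lie in both polarizations whatever `y` is. Once `y` is known to agree, the
  -- polarizations coincide and the odd `x`-entries can be compared.
  have hy : F.y = F'.y := y_eq_of_char_eq he (F := F.cosetRep t • F) fun β =>
    key _ (F.center_mem_polar β) (F'.center_mem_polar β)
  have hpolar := polar_congr hy
  rw [← MulAction.orbit_smul (F.cosetRep t) F]
  refine mem_orbit_of_eq_on_odd hy.symm fun i hi => ?_
  exact (x_eq_of_char_eq he hi fun h (hh : h ∈ F.polar) => key h hh (hpolar ▸ hh)).symm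

lemma exists_deltaVec_mem (he : e ≠ 1) (F : TDDual n K) (W : Submodule ℂ F.RepSpace)
    (hW : ∀ g, ∀ v ∈ W, F.orbitRep e g v ∈ W) {v : F.RepSpace} (hv : v ∈ W) (hv0 : v ≠ 0) :
    ∃ t, F.deltaVec t ∈ W := by
  classical
  -- Induction on the size of the support of `v`.
  suffices H : ∀ m, ∀ v ∈ W, v ≠ 0 → (Finset.univ.filter fun t => F.model v t ≠ 0).card = m →
      ∃ t, F.deltaVec t ∈ W from H _ v hv hv0 rfl
  intro m
  induction m using Nat.strong_induction_on with
  | _ m ih =>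
    intro v hv hv0 hm
    obtain ⟨t, ht⟩ : ∃ t, F.model v t ≠ 0 := by
      by_contra! h
      exact hv0 (F.model.map_eq_zero_iff.1 (funext h))
    by_cases hex : ∃ s, s ≠ t ∧ F.model v s ≠ 0
    · obtain ⟨s, hst, hs⟩ := hex
      obtain ⟨h, hh, hne⟩ : ∃ h ∈ F.polar,
          e ((F.cosetRep s • F).traceForm h) ≠ e ((F.cosetRep t • F).traceForm h) := by
        by_contra! hcon
        exact hst (F.eq_of_char_cosetRep_eq he hcon)
      -- This combination kills the coordinate at `t` and keeps the one at `s`, so the support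
      -- shrinks without becoming empty.
      let w := F.orbitRep e h v - e ((F.cosetRep t • F).traceForm h) • v
      have hw : ∀ r, F.model w r = (e ((F.cosetRep r • F).traceForm h) -
          e ((F.cosetRep t • F).traceForm h)) * F.model v r := fun r => by
        rw [map_sub, map_smul, Pi.sub_apply, Pi.smul_apply, model_orbitRep,
          F.traceForm_cocycle_of_mem_polar r hh, F.cosetShift_of_mem_polar r hh, smul_eq_mul,
          sub_mul]
      refine ih _ ?_ w (W.sub_mem (hW h v hv) (W.smul_mem _ hv)) ?_ rfl
      · rw [← hm]
        refine Finset.card_lt_card ⟨fun r hr => ?_, fun hsub => ?_⟩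
        · rw [Finset.mem_filter, hw] at hr
          exact Finset.mem_filter.2 ⟨Finset.mem_univ _, right_ne_zero_of_mul hr.2⟩
        · have := hsub (Finset.mem_filter.2 ⟨Finset.mem_univ t, ht⟩)
          rw [Finset.mem_filter, hw, sub_self, zero_mul] at this
          exact this.2 rfl
      · intro h0
        have := hw s
        rw [h0, map_zero, Pi.zero_apply] at this
        exact mul_ne_zero (sub_ne_zero.2 hne) hs this.symm
    · push Not at hex
      refine ⟨t, ?_⟩
      have : v = F.model v t • F.deltaVec t := by
        conv_lhs => rw [F.eq_sum_deltaVec v]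
        exact Finset.sum_eq_single t (fun s _ hs => by rw [hex s hs, zero_smul])
          (fun h => absurd (Finset.mem_univ t) h)
      rw [this] at hv
      exact (W.smul_mem_iff ht).1 hv

lemma isIrreducible_orbitRep (he : e ≠ 1) (F : TDDual n K) : (F.orbitRep e).IsIrreducible := by
  classical
  have hnt : Nontrivial F.RepSpace := F.model.toEquiv.nontrivial
  refine { exists_pair_ne := ⟨⊥, ⊤, fun h => ?_⟩, eq_bot_or_eq_top := fun W => ?_ }
  · obtain ⟨v, hv⟩ := exists_ne (0 : F.RepSpace)
    have h1 : v ∈ (⊥ : Subrepresentation (F.orbitRep e)) := by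
      rw [h]
      exact Submodule.mem_top
    exact hv ((Submodule.mem_bot ℂ).1 h1)
  · rw [or_iff_not_imp_left]
    intro hW
    obtain ⟨v, hv, hv0⟩ : ∃ v ∈ W.toSubmodule, v ≠ 0 := by
      apply Submodule.exists_mem_ne_zero_of_ne_bot
      intro h
      exact hW (Subrepresentation.toSubmodule_injective h)
    have hinv : ∀ g, ∀ v ∈ W.toSubmodule, F.orbitRep e g v ∈ W.toSubmodule :=
      fun g v hv => W.apply_mem_toSubmodule g hv
    obtain ⟨t, ht⟩ := F.exists_deltaVec_mem he W.toSubmodule hinv hv hv0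
    apply Subrepresentation.toSubmodule_injective
    refine Submodule.eq_top_iff'.2 fun w => ?_
    rw [F.eq_sum_deltaVec w]
    refine Submodule.sum_mem _ fun s _ => Submodule.smul_mem _ _ ?_
    obtain ⟨c, g, h⟩ := F.exists_smul_orbitRep_eq_deltaVec e t s
    rw [← h]
    exact Submodule.smul_mem _ _ (hinv g _ ht)

lemma IsEigenfunctional.nonempty_equiv {V : Type*} [AddCommGroup V] [Module ℂ V]
    {ρ : Representation ℂ (TDGroup n K) V} (he : e ≠ 1) [ρ.IsIrreducible] {F : TDDual n K}
    {l : V →ₗ[ℂ] ℂ} (hl : IsEigenfunctional ρ e F l) : Nonempty (ρ.Equiv (F.orbitRep e)) := by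
  have := F.isIrreducible_orbitRep he
  -- The Frobenius map `v ↦ (t ↦ l (ρ (s(t)) v))`. Its value at `t = 0` is `l v`, so it is not zero
  -- and Schur's lemma applies.
  let L : V →ₗ[ℂ] F.RepSpace :=
    F.model.symm.toLinearMap ∘ₗ LinearMap.pi fun t => l ∘ₗ ρ (F.cosetRep t)
  have hL : ∀ v t, F.model (L v) t = l (ρ (F.cosetRep t) v) := fun v t => by
    show F.model (F.model.symm _) t = _
    rw [LinearEquiv.apply_symm_apply]
    rfl
  have hint : ∀ g v, L (ρ g v) = F.orbitRep e g (L v) := fun g v => by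
    apply F.model.injective
    funext t
    rw [model_orbitRep, hL, hL, ← hl.2 _ (F.cocycle_mem t g), ← Module.End.mul_apply,
      ← Module.End.mul_apply, ← map_mul, ← map_mul, cocycle_mul_cosetRep]
  let φ : ρ.IntertwiningMap (F.orbitRep e) := ⟨L, fun g => LinearMap.ext fun v => hint g v⟩
  rcases Representation.IsIrreducible.bijective_or_eq_zero φ with h | h
  · exact ⟨φ.ofBijective h⟩
  · exfalso
    refine hl.1 (LinearMap.ext fun v => ?_)
    have h1 : L v = 0 := congrArg (fun ψ : ρ.IntertwiningMap (F.orbitRep e) => ψ v) h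
    have h2 := hL v 0
    rw [h1, map_zero, Pi.zero_apply, cosetRep_zero, map_one] at h2
    exact h2.symm

end TDDual

/-! ### The main theorem -/

lemma CoadjointOrbit.orbit_eq_of_mem {n : ℕ} {K : Type*} [Field K] {Ω : CoadjointOrbit n K}
    {F : TDDual n K} (hF : F ∈ Ω.orbit) : Ω.orbit = MulAction.orbit (TDGroup n K) F := by
  obtain rfl := MulAction.orbitRel.Quotient.mem_orbit.1 hF
  rfl

theorem mainTheorem3 {K : Type*} [Field K] [Fintype K] (n : ℕ) (hn : 1 ≤ n)
    (e : AddChar K ℂ) (he : e ≠ 1) :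
    -- each orbit contains exactly one standard representative
    (∀ Ω : CoadjointOrbit n K, ∃! F : TDDual n K, F ∈ Ω.orbit ∧ F.IsStandard) ∧
    -- for every choice of representatives `F Ω ∈ Ω`, with `π_Ω = (F Ω).orbitRep e`
    ∀ F : CoadjointOrbit n K → TDDual n K, (∀ Ω, F Ω ∈ Ω.orbit) →
      -- dimensions
      (∀ Ω : CoadjointOrbit n K, ∃ k : ℕ, Ω.dim = 2 * k ∧
        Nat.card Ω.orbit = Fintype.card K ^ (2 * k) ∧
        Module.finrank ℂ (F Ω).RepSpace = Fintype.card K ^ k) ∧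
      -- irreducibility
      (∀ Ω : CoadjointOrbit n K, ((F Ω).orbitRep e).IsIrreducible) ∧
      -- different orbits give inequivalent representations
      (∀ Ω Ω' : CoadjointOrbit n K, Ω ≠ Ω' →
        IsEmpty (((F Ω).orbitRep e).Equiv ((F Ω').orbitRep e))) ∧
      -- the sum of the squares of the dimensions is the order of the group
      (∑ Ω : CoadjointOrbit n K, Module.finrank ℂ (F Ω).RepSpace ^ 2 = Nat.card (TDGroup n K)) ∧
      Nat.card (TDGroup n K) = Fintype.card K ^ (2 * n - 1) ∧
      -- completeness
      (∀ (V : Type*) [AddCommGroup V] [Module ℂ V] (ρ : Representation ℂ (TDGroup n K) V),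
        ρ.IsIrreducible →
          ∃! Ω : CoadjointOrbit n K, Nonempty (ρ.Equiv ((F Ω).orbitRep e))) := by
  refine ⟨fun Ω => ?_, fun F hF => ?_⟩
  · induction Ω using Quotient.inductionOn' with
    | _ F =>
      obtain ⟨F', h1, h2⟩ := F.exists_isStandard_mem_orbit
      refine ⟨F', ⟨h1, h2⟩, fun F'' ⟨h3, h4⟩ => ?_⟩
      refine h2.eq_of_mem_orbit h4 ?_
      rw [MulAction.orbit_eq_iff.2 h1]
      exact h3
  have hcard : ∀ Ω : CoadjointOrbit n K,
      Nat.card Ω.orbit = Fintype.card K ^ (2 * Nat.card (F Ω).EvenPos) := fun Ω => by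
    rw [Ω.orbit_eq_of_mem (hF Ω), TDDual.card_orbit]
  have hmk : ∀ Ω, (Quotient.mk'' (F Ω) : CoadjointOrbit n K) = Ω := fun Ω =>
    MulAction.orbitRel.Quotient.mem_orbit.1 (hF Ω)
  have hinj : ∀ Ω Ω' : CoadjointOrbit n K,
      Nonempty (((F Ω).orbitRep e).Equiv ((F Ω').orbitRep e)) → Ω = Ω' := by
    rintro Ω Ω' ⟨φ⟩
    have hl := (TDDual.isEigenfunctional_orbitRep e (F Ω')).comp_equiv φ
    rw [← hmk Ω, ← hmk Ω']
    exact (MulAction.orbitRel.Quotient.mem_orbit.1 (hl.mem_orbit he)).symm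
  refine ⟨fun Ω => ⟨Nat.card (F Ω).EvenPos, ?_, hcard Ω, TDDual.finrank_repSpace _⟩,
    fun Ω => TDDual.isIrreducible_orbitRep he _, fun Ω Ω' hne => ?_, ?_, ?_, ?_⟩
  · rw [CoadjointOrbit.dim, Ω.orbit_eq_of_mem (hF Ω), TDDual.finrank_vectorSpan_orbit]
  · exact not_nonempty_iff.1 fun h => hne (hinj Ω Ω' h)
  · rw [TDGroup.card_eq, ← CoadjointOrbit.sum_card_orbit]
    refine Finset.sum_congr rfl fun Ω _ => ?_
    rw [hcard, TDDual.finrank_repSpace, ← pow_mul, mul_comm]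
  · rw [TDGroup.card_eq, TDDual.card_eq hn]
  · intro V _ _ ρ hρ
    have hnt : Nontrivial V := by
      by_contra h
      rw [not_nontrivial_iff_subsingleton] at h
      refine bot_ne_top (α := Subrepresentation ρ) ?_
      exact Subrepresentation.toSubmodule_injective (Subsingleton.elim _ _)
    obtain ⟨F₀, l, hl⟩ := TDDual.exists_isEigenfunctional he ρ
    let Ω : CoadjointOrbit n K := Quotient.mk'' F₀
    obtain ⟨g, hg⟩ : F Ω ∈ MulAction.orbit (TDGroup n K) F₀ := hF Ω
    have hg' : g • F₀ = F Ω := hg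
    -- The eigenfunctional was found for some `F₀`; translating by `g` moves it to the chosen
    -- representative of its orbit.
    have hlg := hl.smul g
    rw [hg'] at hlg
    obtain ⟨φ⟩ := hlg.nonempty_equiv he
    exact ⟨Ω, ⟨φ⟩, fun Ω' ⟨ψ⟩ => hinj Ω' Ω ⟨ψ.symm.trans φ⟩⟩
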